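/- Let $s\ge 2$ and $t$ be coprime natural numbers, let $n\ge 1$, and put $N=nt$ and $c=\frac12(s-1)(t-1)$. Let $\tilde{\mathfrak S}_s$ be the affine symmetric group, i.e. the group of permutations $w$ of $\mathbb Z$ with $w(m+s)=w(m)+s$ for all $m$ and $w(0)+\dots+w(s-1)=\binom s2$; it is generated by the elements $w_i$ ($i\in\mathbb Z/s\mathbb Z$), where $w_i$ adds $1$ to the integers congruent to $i-1$ modulo $s$, subtracts $1$ from those congruent to $i$, and fixes all others. The level $t$ action $w\mapsto\mathring w$ of $\tilde{\mathfrak S}_s$ on $\mathbb Z$ is the action in which $\mathring w_i$ adds $t$ to the integers congruent to $(i-1)t-c$ modulo $s$, subtracts $t$ from those congruent to $it-c$, and fixes all others. For a partition $\lambda$ write $\mathcal B^\lambda=\{\lambda_i-i\mid i\ge1\}$ for its beta-set. An $s$-core is a partition with no rim hook of size $s$; an $(s,t)$-core is a partition that is both an $s$-core and a $t$-core; the $t$-core of a partition is the $t$-core obtained by repeatedly removing rim hooks of size $t$. The $s$-set $\mathcal S(\lambda)$ of an $s$-core $\lambda$ consists, for each residue class modulo $s$, of the least integer in that class not in $\mathcal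 B^\lambda$. The level $t$ action $w\mapsto\check w$ on the set of all $s$-cores is given by $\mathcal B^{\check w\lambda}=\mathring w\,\mathcal B^\lambda$, and $\mathrm{Stab}_{s,t}(\lambda)$ is the stabiliser of $\lambda$ under this action. Let $\mathcal C_s^{(N)}$ be the set of all $s$-cores $\lambda$ with $k-l<Ns$ for all $k,l\in\mathcal S(\lambda)$. For $s$-cores $\lambda,\mu$ write $\lambda\equiv_N\mu$ if there is a bijection $f:\mathcal S(\lambda)\to\mathcal S(\mu)$ with $f(k)\equiv k\pmod{Ns}$ for all $k$. The level $t$ action $w\mapsto\hat w$ on $\mathcal C_s^{(N)}$ sends $\lambda$ to the unique $\hat w\lambda\in\mathcal C_s^{(N)}$ with $\check w\lambda\equiv_N\hat w\lambda$. Then $\check{\phantom w}$ and $\hat{\phantom w}$ are well-defined actions of $\tilde{\mathfrak S}_s$ on the set of all $s$-cores and on $\mathcal C_s^{(nt)}$ respectively, the set $\mathcal C_s^{(nt)}$ is finite, and it contains every $(s,t)$-core. For every $\lambda\in\mathcal C_s^{(nt)}$ the group $\mathrm{Stab}_{s,t}(\lambda)$ is finite, and the orbit of $\lambda$ under the level $t$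 action on $\mathcal C_s^{(nt)}$ has size $$\frac{n^{s-1}\,s!}{|\mathrm{Stab}_{s,t}(\lambda)|}.$$ This orbit contains exactly one $(s,t)$-core, and this $(s,t)$-core is the $t$-core of every member of the orbit. -/

import Mathlib

open scoped Nat

/-! ### The affine symmetric group -/

theorem periodic_add_mul {s : ℕ} (f : ℤ → ℤ) (hf : ∀ m, f (m + s) = f m) :
    ∀ k m : ℤ, f (m + s * k) = f m := by
  intro k
  induction k using Int.induction_on with
  | zero => simp
  | succ i ih => intro m; rw [← ih m, ← hf (m + s * i)]; congr 1; ring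
  | pred i ih => intro m; rw [← ih m, ← hf (m + s * (-i - 1))]; congr 1; ring

theorem equivariant_add_mul {s : ℕ} (w : ℤ → ℤ) (hw : ∀ m, w (m + s) = w m + s) :
    ∀ k m : ℤ, w (m + s * k) = w m + s * k := by
  intro k m
  have h := periodic_add_mul (fun m => w m - m) (fun m => by rw [hw]; ring) k m
  linarith

theorem sum_range_comp_of_periodic {s : ℕ} (w : Equiv.Perm ℤ)
    (hw : ∀ m, w (m + s) = w m + s) (f : ℤ → ℤ) (hf : ∀ m, f (m + s) = f m) :
    ∑ m ∈ Finset.range s, f (w m) = ∑ m ∈ Finset.range s, f m := by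
  rcases Nat.eq_zero_or_pos s with rfl | hs
  · simp
  have hs' : (s : ℤ) ≠ 0 := by exact_mod_cast hs.ne'
  have hfk := periodic_add_mul f hf
  have hwk := equivariant_add_mul w hw
  have key : ∀ m : ℤ, ((m % s).toNat : ℤ) = m % s :=
    fun m => Int.toNat_of_nonneg (Int.emod_nonneg m hs')
  have hmaps : Set.MapsTo (fun m : ℕ => ((w m) % s).toNat)
      (Finset.range s : Finset ℕ) (Finset.range s : Finset ℕ) := by
    intro m _
    have := Int.emod_lt_of_pos (w m) (by exact_mod_cast hs : (0 : ℤ) < s)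
    have h2 := key (w m)
    simp only [Finset.coe_range, Set.mem_Iio]
    omega
  have hinj : Set.InjOn (fun m : ℕ => ((w m) % s).toNat) (Finset.range s : Finset ℕ) := by
    intro a ha b hb hab
    simp only [Finset.coe_range, Set.mem_Iio] at ha hb
    have h1 : w a % s = w b % s := by
      rw [← key (w a), ← key (w b)]; exact_mod_cast hab
    have h2 : w a = w (b + s * (w a / s - w b / s)) := by
      rw [hwk]
      have e1 := Int.mul_ediv_add_emod (w a) s
      have e2 := Int.mul_ediv_add_emod (w b) s
      rw [h1] at e1
      linarith
    have h3 : (a : ℤ) % s = b % s := by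
      rw [w.injective h2]; simp
    rw [Int.emod_eq_of_lt (by omega) (by omega), Int.emod_eq_of_lt (by omega) (by omega)] at h3
    exact_mod_cast h3
  refine Finset.sum_nbij (fun m : ℕ => ((w m) % s).toNat) hmaps hinj ?_ ?_
  · exact Finset.surjOn_of_injOn_of_card_le _ hmaps hinj le_rfl
  · intro m _
    rw [key]
    conv_lhs => rw [← Int.emod_add_mul_ediv (w m) s]
    exact hfk _ _

theorem sum_range_cast (s : ℕ) : ∑ m ∈ Finset.range s, (m : ℤ) = s.choose 2 := by
  rw [Nat.choose_two_right, ← Finset.sum_range_id]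
  push_cast
  rfl

/-- The affine symmetric group of degree `s`: the permutations `w` of `ℤ` with
`w (m + s) = w m + s` for all `m` and `w 0 + w 1 + ⋯ + w (s - 1) = binom s 2`. -/
def AffineSym (s : ℕ) : Subgroup (Equiv.Perm ℤ) where
  carrier := {w | (∀ m, w (m + s) = w m + s) ∧ ∑ m ∈ Finset.range s, w m = s.choose 2}
  one_mem' := ⟨fun _ => rfl, sum_range_cast s⟩
  mul_mem' := by
    rintro v w ⟨hv, hv'⟩ ⟨hw, hw'⟩
    refine ⟨fun m => by simp [hv, hw], ?_⟩
    have h := sum_range_comp_of_periodic w hw (fun m => v m - m) (fun m => by simp [hv])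
    simp only [Finset.sum_sub_distrib, hv', hw', sum_range_cast] at h
    rw [Equiv.Perm.coe_mul]
    simp only [Function.comp_apply]
    linarith
  inv_mem' := by
    rintro w ⟨hw, hw'⟩
    have hi : ∀ m, w⁻¹ (m + s) = w⁻¹ m + s := by
      intro m
      apply w.injective
      simp [hw]
    refine ⟨hi, ?_⟩
    have h := sum_range_comp_of_periodic w hw (fun m => w⁻¹ m - m) (fun m => by simp [hi])
    simp only [Finset.sum_sub_distrib, hw', sum_range_cast] at h
    have e : ∀ x, w⁻¹ (w x) = x := w.symm_apply_apply
    simp only [e, sum_range_cast] at h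
    linarith

theorem sum_range_ite_dvd {s : ℕ} (hs : 0 < s) (i c : ℤ) :
    ∑ m ∈ Finset.range s, (if (s : ℤ) ∣ (m : ℤ) - i then c else 0) = c := by
  have hs' : (0 : ℤ) < s := by exact_mod_cast hs
  have h0 := Int.emod_nonneg i hs'.ne'
  have h1 := Int.emod_lt_of_pos i hs'
  have h2 : (((i % s).toNat : ℕ) : ℤ) = i % s := Int.toNat_of_nonneg h0
  rw [Finset.sum_eq_single (i % s).toNat]
  · rw [if_pos]
    rw [h2]
    exact (Int.modEq_iff_dvd).1 (Int.mod_modEq i s).symm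
  · intro b hb hbi
    rw [if_neg]
    intro hd
    apply hbi
    have h3 := (Int.modEq_iff_dvd.2 hd).symm
    rw [Int.ModEq, Int.emod_eq_of_lt (by omega) (by simpa using hb)] at h3
    omega
  · intro h
    exact absurd (Finset.mem_range.2 (by omega)) h

/-- The number `(s - 1) (t - 1) / 2`, an integer when `s` and `t` are coprime. -/
def halfProd (s t : ℕ) : ℤ := (((s - 1) * (t - 1) / 2 : ℕ) : ℤ)

/-- The generator with index `i` (mod `s`) of the level `t` action on `ℤ`: it adds `t` to the
integers in the class of `(i - 1) t - (s-1)(t-1)/2` modulo `s`, subtracts `t` from those in the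
class of `i t - (s-1)(t-1)/2`, and fixes all others. -/
def levelGenerator (s t : ℕ) (i m : ℤ) : ℤ :=
  if m ≡ (i - 1) * t - halfProd s t [ZMOD s] then m + t
  else if m ≡ i * t - halfProd s t [ZMOD s] then m - t
  else m

theorem levelGenerator_one (s : ℕ) (i m : ℤ) :
    levelGenerator s 1 i m =
      if (s : ℤ) ∣ m - (i - 1) then m + 1 else if (s : ℤ) ∣ m - i then m - 1 else m := by
  have h : ∀ j : ℤ, m ≡ j [ZMOD s] ↔ (s : ℤ) ∣ m - j := fun j =>
    ⟨fun h => Int.modEq_iff_dvd.1 h.symm, fun h => (Int.modEq_iff_dvd.2 h).symm⟩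
  simp [levelGenerator, halfProd, h]

theorem levelGenerator_one_involutive {s : ℕ} (hs : 2 ≤ s) (i : ℤ) :
    Function.Involutive (levelGenerator s 1 i) := by
  intro m
  have h1 : ¬ (s : ℤ) ∣ 1 := by
    intro h
    have := Int.le_of_dvd one_pos h
    omega
  simp only [levelGenerator_one]
  by_cases ha : (s : ℤ) ∣ m - (i - 1)
  · have h2 : ¬ (s : ℤ) ∣ m + 1 - (i - 1) := fun h =>
      h1 (by have := dvd_sub h ha; ring_nf at this; exact this)
    have h3 : (s : ℤ) ∣ m + 1 - i := by convert ha using 1; ring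
    simp [ha, h2, h3]
  · by_cases hb : (s : ℤ) ∣ m - i
    · have h3 : (s : ℤ) ∣ m - 1 - (i - 1) := by convert hb using 1; ring
      simp [ha, hb]
    · simp [ha, hb]

theorem levelGenerator_one_add (s : ℕ) (i m : ℤ) :
    levelGenerator s 1 i (m + s) = levelGenerator s 1 i m + s := by
  have h : ∀ j : ℤ, (s : ℤ) ∣ m + s - j ↔ (s : ℤ) ∣ m - j := fun j => by
    rw [show m + s - j = (m - j) + s by ring]; exact dvd_add_self_right
  simp only [levelGenerator_one, h]
  split_ifs <;> ring

/-- The standard generator `w_i` of the affine symmetric group: it adds `1` to the integers in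
the class of `i - 1` modulo `s`, subtracts `1` from those in the class of `i`, and fixes all
others. -/
def simpleReflection (s : ℕ) (hs : 2 ≤ s) (i : ℤ) : AffineSym s :=
  ⟨(levelGenerator_one_involutive hs i).toPerm _, levelGenerator_one_add s i, by
    have h : ∀ m : ℤ, levelGenerator s 1 i m = m +
        ((if (s : ℤ) ∣ m - (i - 1) then 1 else 0) - (if (s : ℤ) ∣ m - i then 1 else 0)) := by
      intro m
      have h1 : ¬ (s : ℤ) ∣ 1 := by
        intro h
        have := Int.le_of_dvd one_pos h
        omega
      rw [levelGenerator_one]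
      by_cases ha : (s : ℤ) ∣ m - (i - 1)
      · have h2 : ¬ (s : ℤ) ∣ m - i := fun h =>
          h1 (by have := dvd_sub ha h; ring_nf at this; exact this)
        simp [ha, h2]
      · by_cases hb : (s : ℤ) ∣ m - i
        · simp [ha, hb]; ring
        · simp [ha, hb]
    simp only [Function.Involutive.coe_toPerm, h, Finset.sum_add_distrib,
      Finset.sum_sub_distrib, sum_range_cast, sum_range_ite_dvd (show 0 < s by omega)]
    ring⟩

theorem simpleReflection_apply (s : ℕ) (hs : 2 ≤ s) (i m : ℤ) :
    (simpleReflection s hs i : Equiv.Perm ℤ) m = levelGenerator s 1 i m := rfl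

theorem eq_one_of_lt {s : ℕ} (hs : 2 ≤ s) (w : AffineSym s)
    (h : ∀ i : ℤ, (w : Equiv.Perm ℤ) i < (w : Equiv.Perm ℤ) (i + 1)) : w = 1 := by
  obtain ⟨w, hw, hw'⟩ := w
  simp only at h
  have hm : StrictMono w := strictMono_int_of_lt_succ h
  have hstep : ∀ i : ℤ, w (i + 1) = w i + 1 := by
    intro i
    obtain ⟨j, hj⟩ := w.surjective (w i + 1)
    have h1 : i < j := hm.lt_iff_lt.1 (by omega)
    have h2 : w (i + 1) ≤ w j := hm.monotone (by omega)
    have h3 := h i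
    omega
  have h1 := equivariant_add_mul (s := 1) w (by simpa using hstep)
  have h2 : ∀ k : ℤ, w k = w 0 + k := fun k => by simpa using h1 k 0
  have h3 : w 0 = 0 := by
    have e : ∀ m : ℕ, w (m : ℤ) = w 0 + m := fun m => h2 m
    simp only [e, Finset.sum_add_distrib, sum_range_cast, Finset.sum_const, Finset.card_range]
      at hw'
    have : (s : ℤ) * w 0 = 0 := by simpa using hw'
    rcases mul_eq_zero.1 this with h | h
    · omega
    · exact h
  apply Subtype.ext
  ext k
  simpa [h3] using h2 k

theorem closure_simpleReflection (s : ℕ) (hs : 2 ≤ s) :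
    Subgroup.closure (Set.range (simpleReflection s hs)) = ⊤ := by
  have main : ∀ (n : ℕ) (w : AffineSym s),
      ∑ m ∈ Finset.range s, ((w : Equiv.Perm ℤ) m - m) ^ 2 = (n : ℤ) →
      w ∈ Subgroup.closure (Set.range (simpleReflection s hs)) := by
    intro n
    induction n using Nat.strong_induction_on with
    | _ n ih =>
      intro w hn
      by_cases hlt : ∀ i : ℤ, (w : Equiv.Perm ℤ) i < (w : Equiv.Perm ℤ) (i + 1)
      · rw [eq_one_of_lt hs w hlt]
        exact one_mem _
      push Not at hlt
      obtain ⟨i, hi⟩ := hlt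
      have hne : (w : Equiv.Perm ℤ) (i + 1) ≠ (w : Equiv.Perm ℤ) i := fun h => by
        have := (w : Equiv.Perm ℤ).injective h
        omega
      have hw := w.2.1
      set r := simpleReflection s hs (i + 1) with hr
      have hrr : ∀ m, (r : Equiv.Perm ℤ) ((r : Equiv.Perm ℤ) m) = m :=
        levelGenerator_one_involutive hs (i + 1)
      have hrs := r.2.1
      have hd := equivariant_add_mul (w : Equiv.Perm ℤ) hw
      have hdiff : ∀ m : ℤ, ((w : Equiv.Perm ℤ) m - (r : Equiv.Perm ℤ) m) ^ 2 =
          ((w : Equiv.Perm ℤ) m - m) ^ 2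
          + ((if (s : ℤ) ∣ m - i then 1 - 2 * ((w : Equiv.Perm ℤ) i - i) else 0)
          + (if (s : ℤ) ∣ m - (i + 1)
              then 1 + 2 * ((w : Equiv.Perm ℤ) (i + 1) - (i + 1)) else 0)) := by
        intro m
        have h1 : ¬ (s : ℤ) ∣ 1 := by
          intro h
          have := Int.le_of_dvd one_pos h
          omega
        rw [hr, simpleReflection_apply, levelGenerator_one, show i + 1 - 1 = i by ring]
        by_cases ha : (s : ℤ) ∣ m - i
        · have h2 : ¬ (s : ℤ) ∣ m - (i + 1) := fun h =>
            h1 (by have := dvd_sub ha h; ring_nf at this; exact this)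
          obtain ⟨k, hk⟩ := ha
          have hm : m = i + s * k := by linarith
          have h4 := hd k i
          rw [← hm] at h4
          rw [if_pos ⟨k, hk⟩, if_pos ⟨k, hk⟩, if_neg h2, h4, hm]
          ring
        · by_cases hb : (s : ℤ) ∣ m - (i + 1)
          · obtain ⟨k, hk⟩ := hb
            have hm : m = (i + 1) + s * k := by linarith
            have h4 := hd k (i + 1)
            rw [← hm] at h4
            rw [if_neg ha, if_neg ha, if_pos ⟨k, hk⟩, if_pos ⟨k, hk⟩, h4, hm]
            ring
          · simp [ha, hb]
      have hsum : ∑ m ∈ Finset.range s, (((w * r : AffineSym s) : Equiv.Perm ℤ) m - m) ^ 2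
          = n + 2 * ((w : Equiv.Perm ℤ) (i + 1) - (w : Equiv.Perm ℤ) i) := by
        have h := sum_range_comp_of_periodic (r : Equiv.Perm ℤ) hrs
          (fun m => ((w : Equiv.Perm ℤ) m - (r : Equiv.Perm ℤ) m) ^ 2)
          (fun m => by simp only [hw, hrs]; ring)
        simp only [hrr] at h
        simp only [Subgroup.coe_mul, Equiv.Perm.mul_apply]
        rw [h]
        simp only [hdiff, Finset.sum_add_distrib, hn,
          sum_range_ite_dvd (show 0 < s by omega)]
        ring
      have hnn : (0 : ℤ) ≤
          ∑ m ∈ Finset.range s, (((w * r : AffineSym s) : Equiv.Perm ℤ) m - m) ^ 2 :=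
        Finset.sum_nonneg fun _ _ => sq_nonneg _
      have hmem := ih (∑ m ∈ Finset.range s,
        (((w * r : AffineSym s) : Equiv.Perm ℤ) m - m) ^ 2).toNat (by omega) (w * r)
        (Int.toNat_of_nonneg hnn).symm
      have hrm : r ∈ Subgroup.closure (Set.range (simpleReflection s hs)) :=
        Subgroup.subset_closure ⟨i + 1, rfl⟩
      simpa using mul_mem hmem (inv_mem hrm)
  refine eq_top_iff.2 fun w _ => ?_
  exact main _ w (Int.toNat_of_nonneg (Finset.sum_nonneg fun _ _ => sq_nonneg _)).symm

/-! ### The level `t` action on `ℤ` -/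

/-- An integer `i` with `i t ≡ m + (s-1)(t-1)/2` modulo `s`, when `s` and `t` are coprime
(see `levelIndex_mul`). -/
def levelIndex (s t : ℕ) (m : ℤ) : ℤ := Nat.gcdA t s * (m + halfProd s t)

theorem levelIndex_mul {s t : ℕ} (h : s.Coprime t) (m : ℤ) :
    levelIndex s t m * t ≡ m + halfProd s t [ZMOD s] := by
  have h1 := Nat.gcd_eq_gcd_ab t s
  rw [h.symm] at h1
  rw [Int.modEq_iff_dvd]
  refine ⟨Nat.gcdB t s * (m + halfProd s t), ?_⟩
  rw [levelIndex]
  push_cast at h1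
  linear_combination (m + halfProd s t) * h1

theorem modEq_of_mul_modEq {s t : ℕ} (h : s.Coprime t) {a b : ℤ}
    (hab : a * t ≡ b * t [ZMOD s]) : a ≡ b [ZMOD s] := by
  rw [Int.modEq_iff_dvd] at hab ⊢
  rw [← sub_mul] at hab
  exact (Nat.isCoprime_iff_coprime.2 h).dvd_of_dvd_mul_right hab

theorem displacement_congr {s : ℕ} (w : AffineSym s) {a b : ℤ} (h : a ≡ b [ZMOD s]) :
    (w : Equiv.Perm ℤ) a - a = (w : Equiv.Perm ℤ) b - b := by
  obtain ⟨k, hk⟩ := Int.modEq_iff_dvd.1 h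
  have h1 := equivariant_add_mul (w : Equiv.Perm ℤ) w.2.1 k a
  rw [show b = a + s * k by linarith, h1]
  ring

/-- The level `t` action of `w` on `ℤ`: `m ↦ m + t (w i - i)` where `i t ≡ m + (s-1)(t-1)/2`
modulo `s`. -/
def levelFun (s t : ℕ) (w : AffineSym s) (m : ℤ) : ℤ :=
  m + t * ((w : Equiv.Perm ℤ) (levelIndex s t m) - levelIndex s t m)

theorem levelFun_mul {s t : ℕ} (h : s.Coprime t) (v w : AffineSym s) (m : ℤ) :
    levelFun s t v (levelFun s t w m) = levelFun s t (v * w) m := by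
  have h1 : levelIndex s t (levelFun s t w m) ≡
      (w : Equiv.Perm ℤ) (levelIndex s t m) [ZMOD s] := by
    apply modEq_of_mul_modEq h
    refine (levelIndex_mul h _).trans ?_
    have h2 := (levelIndex_mul h m).symm
    rw [Int.modEq_iff_dvd] at h2 ⊢
    convert h2 using 1
    rw [levelFun]
    ring
  have h2 := displacement_congr v h1
  rw [levelFun, h2]
  simp only [levelFun, Subgroup.coe_mul, Equiv.Perm.mul_apply]
  ring

theorem levelFun_one (s t : ℕ) (m : ℤ) : levelFun s t 1 m = m := by simp [levelFun]

/-- The level `t` action of the affine symmetric group on `ℤ`. By `levelAction_simpleReflection`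
and `eq_levelAction` below, it is the unique action in which each standard generator `w_i` acts
as `levelGenerator s t i`. -/
def levelAction (s t : ℕ) (h : s.Coprime t) : AffineSym s →* Equiv.Perm ℤ where
  toFun w :=
    { toFun := levelFun s t w
      invFun := levelFun s t w⁻¹
      left_inv := fun m => by rw [levelFun_mul h, inv_mul_cancel, levelFun_one]
      right_inv := fun m => by rw [levelFun_mul h, mul_inv_cancel, levelFun_one] }
  map_one' := by ext m; exact levelFun_one s t m
  map_mul' v w := by ext m; exact (levelFun_mul h v w m).symm

theorem levelAction_simpleReflection (s t : ℕ) (hs : 2 ≤ s) (h : s.Coprime t) (i m : ℤ) :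
    levelAction s t h (simpleReflection s hs i) m = levelGenerator s t i m := by
  have key : ∀ j : ℤ, (s : ℤ) ∣ levelIndex s t m - j ↔
      m ≡ j * t - halfProd s t [ZMOD s] := by
    intro j
    have h1 : (s : ℤ) ∣ levelIndex s t m - j ↔ levelIndex s t m ≡ j [ZMOD s] :=
      ⟨fun h => (Int.modEq_iff_dvd.2 h).symm, fun h => Int.modEq_iff_dvd.1 h.symm⟩
    rw [h1]
    constructor
    · intro h2
      have h3 := (levelIndex_mul h m).symm.trans (h2.mul_right t)
      simpa using h3.sub_right (halfProd s t)
    · intro h2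
      apply modEq_of_mul_modEq h
      refine (levelIndex_mul h m).trans ?_
      simpa using h2.add_right (halfProd s t)
  change m + t * (levelGenerator s 1 i (levelIndex s t m) - levelIndex s t m) = _
  rw [levelGenerator_one, levelGenerator]
  simp only [key]
  split_ifs <;> ring

theorem eq_levelAction (s t : ℕ) (hs : 2 ≤ s) (h : s.Coprime t)
    (ρ : AffineSym s →* Equiv.Perm ℤ)
    (hρ : ∀ i m, ρ (simpleReflection s hs i) m = levelGenerator s t i m) :
    ρ = levelAction s t h := by
  refine MonoidHom.eq_of_eqOn_dense (closure_simpleReflection s hs) ?_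
  rintro _ ⟨i, rfl⟩
  ext m
  rw [hρ, levelAction_simpleReflection]

/-! ### Cores, beta-sets and `s`-sets -/

/-- The rim hook of `la` at the cell `x`: the cells `y` weakly below and weakly to the right of
`x` such that the cell diagonally below `y` is not in `la`. -/
def rimHook (la : YoungDiagram) (x : ℕ × ℕ) : Finset (ℕ × ℕ) :=
  la.cells.filter fun y => x.1 ≤ y.1 ∧ x.2 ≤ y.2 ∧ (y.1 + 1, y.2 + 1) ∉ la.cells

/-- `la` is an `s`-core: no hook length of `la`, i.e. no size of a rim hook, equals `s`. -/
def IsCore (s : ℕ) (la : YoungDiagram) : Prop :=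
  ∀ x ∈ la.cells, (rimHook la x).card ≠ s

/-- `mu` is obtained from `la` by removing one rim hook of size `t`. -/
def RemovesRimHook (t : ℕ) (la mu : YoungDiagram) : Prop :=
  ∃ x ∈ la.cells, (rimHook la x).card = t ∧ mu.cells = la.cells \ rimHook la x

/-- `mu` is a `t`-core obtained from `la` by repeatedly removing rim hooks of size `t`. -/
def IsCoreOf (t : ℕ) (mu la : YoungDiagram) : Prop :=
  IsCore t mu ∧ Relation.ReflTransGen (RemovesRimHook t) la mu

/-- The beta-set `{la_i - i | i ≥ 1}` (the rows of a Young diagram are numbered from `0`). -/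
def betaSet (la : YoungDiagram) : Set ℤ :=
  Set.range fun i : ℕ => (la.rowLen i : ℤ) - (i + 1)

/-- The `s`-set of `la`: for each class modulo `s`, the least integer of this class that is
not in the beta-set. -/
def sSet (s : ℕ) (la : YoungDiagram) : Set ℤ :=
  {a | IsLeast {b | b ≡ a [ZMOD s] ∧ b ∉ betaSet la} a}

/-- The set of all `s`-cores. -/
abbrev Cores (s : ℕ) : Type := {la : YoungDiagram // IsCore s la}

/-- The set of all `s`-cores whose `s`-set has spread less than `N s`. -/
abbrev BoundedCores (s N : ℕ) : Type :=
  {la : YoungDiagram // IsCore s la ∧ ∀ k ∈ sSet s la, ∀ l ∈ sSet s la, k - l < N * s}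

/-- The equivalence relation on `s`-cores: there is a bijection between the `s`-sets that
preserves residues modulo `N s`. -/
def CoreCongr (s N : ℕ) (la mu : YoungDiagram) : Prop :=
  ∃ f : sSet s la ≃ sSet s mu, ∀ k, (f k : ℤ) ≡ k [ZMOD ((N * s : ℕ) : ℤ)]

/-! ### The level `t` actions on cores -/

/-- A ternary relation `R g x y` is the graph `g • x = y` of an action of the group `G`. -/
def IsActionGraph {G X : Type*} [Group G] (R : G → X → X → Prop) : Prop :=
  ∃ ρ : G →* Equiv.Perm X, ∀ g x y, R g x y ↔ ρ g x = y

/-- `w` sends the `s`-core `la` to the `s`-core `mu` in the level `t` action on `s`-cores. -/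
def ActsOnCores (s t : ℕ) (h : s.Coprime t) (w : AffineSym s) (la mu : Cores s) : Prop :=
  betaSet mu.1 = levelAction s t h w '' betaSet la.1

/-- `w` sends `la` to `mu` in the level `t` action on the `s`-cores whose `s`-set has spread less
than `N s`: the image of `la` in the level `t` action on all `s`-cores is equivalent to `mu`. -/
def ActsOnBoundedCores (s t N : ℕ) (h : s.Coprime t) (w : AffineSym s)
    (la mu : BoundedCores s N) : Prop :=
  ∃ ka : Cores s, ActsOnCores s t h w ⟨la.1, la.2.1⟩ ka ∧ CoreCongr s N ka.1 mu.1

/-- The stabiliser of the `s`-core `la` in the level `t` action on all `s`-cores. -/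
def coreStabilizer (s t : ℕ) (h : s.Coprime t) (la : Cores s) : Set (AffineSym s) :=
  {w | ActsOnCores s t h w la la}

/-- The orbit of `la` in the level `t` action on the `s`-cores whose `s`-set has spread less
than `N s`. -/
def boundedOrbit (s t N : ℕ) (h : s.Coprime t) (la : BoundedCores s N) :
    Set (BoundedCores s N) :=
  {mu | ∃ w, ActsOnBoundedCores s t N h w la mu}

/-!
In redundant coordinates `(i, v)` on `ℤ` for which the level `t` action is `(i, v) ↦ (w i, v)`, the
beta-set of an `s`-core is the region strictly below the graph of a sequence `y : ℤ → ℤ`, its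
profile. The sequences that occur are those with `y (i + s) = y i - t` whose sum over a period is
`0`; the level `t` action becomes composition with permutations `w` of the indices, and the
equivalence of cores becomes congruence modulo `N = n t`. An `s`-core is a `t`-core exactly if its
profile is antitone.

Call the sum of the squares of the elements of the `s`-set the energy. Within a congruence class of
profiles, a minimum of the energy has an `s`-set of spread less than `N s`, hence bounded cores
represent all classes. Within an orbit, a profile of minimal energy is antitone, since composing
with a simple reflection would otherwise lower the energy; hence each orbit contains a `t`-core. It
is the `t`-core of each member of the orbit, because the charges of the `t`-runners of a beta-set
are unchanged both by the action and by removing rim hooks of size `t`.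

Two profiles `y ∘ v` and `y ∘ w` are congruent modulo `n t` exactly if `v * w⁻¹` lies in the product
of the stabiliser of `y` and the group of the elements that are trivial modulo `n s`. The latter
group has index `n ^ (s - 1) * s !` and meets each stabiliser trivially, which gives the size of the
orbits.
-/

/-! ### Beta-sets and rim hooks -/

/-- The entry of the beta-set of `la` that belongs to row `i`. -/
def bead (la : YoungDiagram) (i : ℕ) : ℤ := (la.rowLen i : ℤ) - (i + 1)

/-- The integer outside the beta-set of `la` that belongs to column `j`: the gaps are the negated
beads of the conjugate partition, shifted by one. -/
def gap (la : YoungDiagram) (j : ℕ) : ℤ := (j : ℤ) - la.colLen j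

theorem bead_mem_betaSet (la : YoungDiagram) (i : ℕ) : bead la i ∈ betaSet la := ⟨i, rfl⟩

theorem bead_strictAnti (la : YoungDiagram) : StrictAnti (bead la) := by
  refine strictAnti_nat_of_succ_lt fun i => ?_
  have := la.rowLen_anti i (i + 1) (Nat.le_succ i)
  simp only [bead]
  omega

theorem lt_rowLen_iff_lt_colLen (la : YoungDiagram) (i j : ℕ) :
    j < la.rowLen i ↔ i < la.colLen j := by
  rw [← YoungDiagram.mem_iff_lt_rowLen, YoungDiagram.mem_iff_lt_colLen]

theorem gap_lt_bead_iff (la : YoungDiagram) (i j : ℕ) :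
    gap la j < bead la i ↔ j < la.rowLen i := by
  have := lt_rowLen_iff_lt_colLen la i j
  simp only [gap, bead]
  omega

theorem bead_ne_gap (la : YoungDiagram) (i j : ℕ) : bead la i ≠ gap la j := by
  have := lt_rowLen_iff_lt_colLen la i j
  simp only [gap, bead]
  omega

theorem gap_notMem_betaSet (la : YoungDiagram) (j : ℕ) : gap la j ∉ betaSet la := by
  rintro ⟨i, hi⟩
  exact bead_ne_gap la i j hi

theorem rowLen_eq_zero_of_colLen_le {la : YoungDiagram} {i : ℕ} (hi : la.colLen 0 ≤ i) :
    la.rowLen i = 0 := by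
  have := lt_rowLen_iff_lt_colLen la i 0
  omega

theorem bead_eq_of_colLen_le {la : YoungDiagram} {i : ℕ} (hi : la.colLen 0 ≤ i) :
    bead la i = -(i + 1) := by
  rw [bead, rowLen_eq_zero_of_colLen_le hi]
  omega

theorem exists_bead_lt (la : YoungDiagram) (x : ℤ) : ∃ i, bead la i < x := by
  refine ⟨la.colLen 0 + x.natAbs, ?_⟩
  rw [bead_eq_of_colLen_le (Nat.le_add_right _ _)]
  omega

theorem exists_gap_eq_of_notMem_betaSet {la : YoungDiagram} {x : ℤ} (hx : x ∉ betaSet la) :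
    ∃ j, gap la j = x := by
  classical
  obtain ⟨h, hlt, hgt⟩ : ∃ h, bead la h < x ∧ ∀ r < h, x < bead la r := by
    have hex := exists_bead_lt la x
    refine ⟨Nat.find hex, Nat.find_spec hex, fun r hr => ?_⟩
    have hne : bead la r ≠ x := fun e => hx ⟨r, e⟩
    exact lt_of_le_of_ne (not_lt.1 (Nat.find_min hex hr)) hne.symm
  simp only [bead] at hlt hgt
  have hcol : la.colLen (x + h).toNat = h := by
    refine eq_of_forall_lt_iff fun r => ?_
    rw [← lt_rowLen_iff_lt_colLen]
    refine ⟨fun hr => ?_, fun hr => ?_⟩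
    · by_contra! hle
      have := la.rowLen_anti h r hle
      omega
    · have := la.rowLen_anti r (h - 1) (by omega)
      have := hgt (h - 1) (by omega)
      omega
  exact ⟨(x + h).toNat, by rw [gap, hcol]; omega⟩

theorem eq_of_forall_rowLen_eq {la mu : YoungDiagram} (h : ∀ i, la.rowLen i = mu.rowLen i) :
    la = mu := by
  apply YoungDiagram.ext
  ext ⟨i, j⟩
  simp only [YoungDiagram.mem_cells, YoungDiagram.mem_iff_lt_rowLen, h]

theorem betaSet_injective : Function.Injective betaSet := by
  intro la mu h
  have hbead : bead la = bead mu :=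
    ((bead_strictAnti la).dual_right.range_inj (bead_strictAnti mu).dual_right).1 h
  refine eq_of_forall_rowLen_eq fun i => ?_
  have := congrFun hbead i
  simp only [bead] at this
  omega

theorem mem_rimHook {la : YoungDiagram} {i j r k : ℕ} :
    (r, k) ∈ rimHook la (i, j) ↔
      k < la.rowLen r ∧ i ≤ r ∧ j ≤ k ∧ la.rowLen (r + 1) ≤ k + 1 := by
  simp [rimHook, YoungDiagram.mem_cells, YoungDiagram.mem_iff_lt_rowLen]

theorem card_filter_fst_rimHook {la : YoungDiagram} {i j r : ℕ} (hi : i ≤ r)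
    (hj : j < la.rowLen r) :
    (((rimHook la (i, j)).filter fun x => x.1 = r).card : ℤ) =
      max (la.rowLen r : ℤ) (j + 1) - max (la.rowLen (r + 1) : ℤ) (j + 1) + 1 := by
  have hrow : (rimHook la (i, j)).filter (fun x => x.1 = r) =
      (Finset.Ico (max j (la.rowLen (r + 1) - 1)) (la.rowLen r)).map
        (Function.Embedding.sectR r ℕ) := by
    ext ⟨r', k⟩
    simp only [Finset.mem_filter, mem_rimHook, Finset.mem_map, Finset.mem_Ico,
      Function.Embedding.sectR_apply, Prod.mk.injEq]
    constructor
    · rintro ⟨hk, hr⟩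
      obtain rfl : r' = r := hr
      exact ⟨k, by omega, rfl, rfl⟩
    · rintro ⟨k, hk, rfl, rfl⟩
      exact ⟨by omega, rfl⟩
  rw [hrow, Finset.card_map, Nat.card_Ico]
  have := la.rowLen_anti r (r + 1) (Nat.le_succ r)
  omega

theorem card_rimHook {la : YoungDiagram} {i j : ℕ} (h : j < la.rowLen i) :
    ((rimHook la (i, j)).card : ℤ) = bead la i - gap la j := by
  have hcol : i ≤ la.colLen j := ((lt_rowLen_iff_lt_colLen la i j).1 h).le
  have hmaps : ∀ x ∈ rimHook la (i, j), x.1 ∈ Finset.Ico i (la.colLen j) := by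
    rintro ⟨r, k⟩ hx
    rw [mem_rimHook] at hx
    exact Finset.mem_Ico.2 ⟨hx.2.1, (lt_rowLen_iff_lt_colLen la r j).1 (by omega)⟩
  have hfibre : ∀ r ∈ Finset.Ico i (la.colLen j),
      (((rimHook la (i, j)).filter fun x => x.1 = r).card : ℤ) =
        ((r + 1 : ℕ) - max (la.rowLen (r + 1) : ℤ) (j + 1)) -
          (r - max (la.rowLen r : ℤ) (j + 1)) := by
    intro r hr
    rw [Finset.mem_Ico, ← lt_rowLen_iff_lt_colLen] at hr
    rw [card_filter_fst_rimHook hr.1 hr.2]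
    push_cast
    ring
  rw [Finset.card_eq_sum_card_fiberwise hmaps, Nat.cast_sum, Finset.sum_congr rfl hfibre,
    Finset.sum_Ico_sub (fun r : ℕ => (r : ℤ) - max (la.rowLen r : ℤ) (j + 1)) hcol]
  have := lt_rowLen_iff_lt_colLen la (la.colLen j) j
  simp only [bead, gap]
  omega

theorem isCore_iff {t : ℕ} (ht : 0 < t) (la : YoungDiagram) :
    IsCore t la ↔ ∀ b ∈ betaSet la, b - t ∈ betaSet la := by
  constructor
  · rintro h _ ⟨i, rfl⟩
    by_contra hb
    obtain ⟨j, hj⟩ := exists_gap_eq_of_notMem_betaSet hb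
    change gap la j = bead la i - t at hj
    have hij : j < la.rowLen i := (gap_lt_bead_iff la i j).1 (by omega)
    refine h (i, j) ?_ ?_
    · rwa [YoungDiagram.mem_cells, YoungDiagram.mem_iff_lt_rowLen]
    · have := card_rimHook hij
      omega
  · rintro h ⟨i, j⟩ hx hcard
    rw [YoungDiagram.mem_cells, YoungDiagram.mem_iff_lt_rowLen] at hx
    have hgap : bead la i - t = gap la j := by
      have := card_rimHook hx
      omega
    exact gap_notMem_betaSet la j (hgap ▸ h _ (bead_mem_betaSet la i))

theorem exists_removesRimHook {t : ℕ} {la : YoungDiagram} (h : ¬ IsCore t la) :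
    ∃ mu, RemovesRimHook t la mu := by
  simp only [IsCore, not_forall, not_not] at h
  obtain ⟨x, hx, hcard⟩ := h
  refine ⟨⟨la.cells \ rimHook la x, ?_⟩, x, hx, hcard, rfl⟩
  rintro y z hzy hy
  simp only [Finset.coe_sdiff, Set.mem_sdiff, Finset.mem_coe, rimHook, Finset.mem_filter,
    not_and, not_not] at hy ⊢
  refine ⟨la.isLowerSet hzy hy.1, fun _ h1 h2 => ?_⟩
  have hdiag : (z.1 + 1, z.2 + 1) ≤ (y.1 + 1, y.2 + 1) :=
    ⟨Nat.succ_le_succ hzy.1, Nat.succ_le_succ hzy.2⟩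
  exact la.isLowerSet hdiag (hy.2 hy.1 (h1.trans hzy.1) (h2.trans hzy.2))

theorem RemovesRimHook.card_lt {t : ℕ} (ht : 0 < t) {la mu : YoungDiagram}
    (h : RemovesRimHook t la mu) : mu.cells.card < la.cells.card := by
  obtain ⟨x, -, hcard, hmu⟩ := h
  have hsub : rimHook la x ⊆ la.cells := Finset.filter_subset _ _
  have := Finset.card_sdiff_add_card_eq_card hsub
  rw [hmu]
  omega

theorem exists_isCoreOf {t : ℕ} (ht : 0 < t) (la : YoungDiagram) : ∃ mu, IsCoreOf t mu la := by
  induction hc : la.cells.card using Nat.strong_induction_on generalizing la with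
  | _ m ih =>
    by_cases h : IsCore t la
    · exact ⟨la, h, Relation.ReflTransGen.refl⟩
    · obtain ⟨nu, hnu⟩ := exists_removesRimHook h
      obtain ⟨mu, hcore, hsteps⟩ := ih _ (hc ▸ hnu.card_lt ht) nu rfl
      exact ⟨mu, hcore, hsteps.head hnu⟩

section RemoveRimHook

variable {la mu : YoungDiagram} {i j : ℕ}

theorem rowLen_eq_of_cells_eq_sdiff_rimHook (hmu : mu.cells = la.cells \ rimHook la (i, j))
    (r : ℕ) : mu.rowLen r = if i ≤ r then min (la.rowLen r) (max j (la.rowLen (r + 1) - 1))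
      else la.rowLen r := by
  refine eq_of_forall_lt_iff fun k => ?_
  rw [← YoungDiagram.mem_iff_lt_rowLen, ← YoungDiagram.mem_cells, hmu, Finset.mem_sdiff,
    mem_rimHook, YoungDiagram.mem_cells, YoungDiagram.mem_iff_lt_rowLen]
  split_ifs <;> omega

-- Removing the rim hook at `(i, j)` shifts the beads of the rows below `i` up by one row and puts
-- the last of them into the gap of column `j`.
theorem bead_eq_of_cells_eq_sdiff_rimHook (hmu : mu.cells = la.cells \ rimHook la (i, j))
    (r : ℕ) : bead mu r = if r < i ∨ la.colLen j ≤ r then bead la r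
      else if r + 1 < la.colLen j then bead la (r + 1) else gap la j := by
  have := lt_rowLen_iff_lt_colLen la r j
  have := lt_rowLen_iff_lt_colLen la (r + 1) j
  have := la.rowLen_anti r (r + 1) (Nat.le_succ r)
  have hlen := rowLen_eq_of_cells_eq_sdiff_rimHook hmu r
  simp only [bead, gap]
  split_ifs at hlen ⊢ <;> omega

theorem betaSet_eq_of_cells_eq_sdiff_rimHook (hij : j < la.rowLen i)
    (hmu : mu.cells = la.cells \ rimHook la (i, j)) :
    betaSet mu = insert (gap la j) (betaSet la \ {bead la i}) := by
  have hbead := bead_eq_of_cells_eq_sdiff_rimHook hmu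
  have hcol : i < la.colLen j := (lt_rowLen_iff_lt_colLen la i j).1 hij
  have hmem : ∀ r, r ≠ i → bead la r ∈ betaSet la \ {bead la i} := fun r hr =>
    ⟨bead_mem_betaSet la r, fun h => hr ((bead_strictAnti la).injective h)⟩
  apply Set.Subset.antisymm
  · rintro _ ⟨r, rfl⟩
    change bead mu r ∈ _
    rw [hbead]
    split_ifs
    · exact Set.mem_insert_of_mem _ (hmem r (by omega))
    · exact Set.mem_insert_of_mem _ (hmem (r + 1) (by omega))
    · exact Set.mem_insert _ _
  · rintro _ (rfl | ⟨⟨r, rfl⟩, hr⟩)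
    · refine ⟨la.colLen j - 1, (hbead _).trans ?_⟩
      rw [if_neg (by omega), if_neg (by omega)]
    · have hri : r ≠ i := by
        rintro rfl
        exact hr rfl
      by_cases hmoved : i < r ∧ r < la.colLen j
      · refine ⟨r - 1, (hbead _).trans ?_⟩
        rw [if_neg (by omega), if_pos (by omega), Nat.sub_add_cancel (by omega)]
        rfl
      · refine ⟨r, (hbead _).trans ?_⟩
        rw [if_pos (by omega)]
        rfl

end RemoveRimHook

theorem RemovesRimHook.exists_betaSet_eq {t : ℕ} {la mu : YoungDiagram}
    (h : RemovesRimHook t la mu) :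
    ∃ b ∈ betaSet la, b - t ∉ betaSet la ∧ betaSet mu = insert (b - t) (betaSet la \ {b}) := by
  obtain ⟨⟨i, j⟩, hx, hcard, hmu⟩ := h
  rw [YoungDiagram.mem_cells, YoungDiagram.mem_iff_lt_rowLen] at hx
  have hgap : bead la i - t = gap la j := by
    have := card_rimHook hx
    omega
  exact ⟨bead la i, bead_mem_betaSet la i, hgap ▸ gap_notMem_betaSet la j,
    hgap ▸ betaSet_eq_of_cells_eq_sdiff_rimHook hx hmu⟩

/-! ### Periodic functions on the integers -/

theorem eq_of_modEq_of_periodic {α : Type*} {s : ℕ} {f : ℤ → α}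
    (hf : Function.Periodic f (s : ℤ)) {a b : ℤ} (h : a ≡ b [ZMOD s]) : f a = f b := by
  obtain ⟨k, hk⟩ := Int.modEq_iff_dvd.1 h
  have hb : b = a + k * (s : ℤ) := by linarith
  rw [hb]
  exact (hf.int_mul k a).symm

theorem sum_range_comp_of_modEq {M : Type*} [AddCommMonoid M] {s : ℕ} {g : ℤ → ℤ}
    (hg : ∀ a b, g a ≡ g b [ZMOD s] → a ≡ b [ZMOD s]) {f : ℤ → M}
    (hf : Function.Periodic f (s : ℤ)) :
    ∑ m ∈ Finset.range s, f (g m) = ∑ m ∈ Finset.range s, f m := by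
  rcases s.eq_zero_or_pos with rfl | hs
  · simp
  have hs' : (0 : ℤ) < s := by exact_mod_cast hs
  let residue (m : Fin s) : Fin s :=
    ⟨(g m % s).toNat, (Int.toNat_lt_of_ne_zero hs.ne').2 (Int.emod_lt_of_pos (g m) hs')⟩
  have hresidue (m : Fin s) : ((residue m : ℕ) : ℤ) = g m % s :=
    Int.toNat_of_nonneg (Int.emod_nonneg _ hs'.ne')
  have hinj : Function.Injective residue := by
    intro a b hab
    have hmod : (a : ℤ) % s = b % s := hg _ _ (by rw [Int.ModEq, ← hresidue, ← hresidue, hab])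
    rw [Int.emod_eq_of_lt (by omega) (by omega), Int.emod_eq_of_lt (by omega) (by omega)] at hmod
    exact Fin.ext (by exact_mod_cast hmod)
  calc ∑ m ∈ Finset.range s, f (g m) = ∑ m : Fin s, f (g m) := Finset.sum_range fun m => f (g m)
    _ = ∑ m : Fin s, f (residue m : ℕ) :=
      Finset.sum_congr rfl fun m _ => eq_of_modEq_of_periodic hf
        (by rw [hresidue]; exact (Int.mod_modEq _ _).symm)
    _ = ∑ m : Fin s, f (m : ℕ) :=
      (Finite.injective_iff_bijective.1 hinj).sum_comp fun m : Fin s => f (m : ℕ)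
    _ = ∑ m ∈ Finset.range s, f m := (Finset.sum_range fun m : ℕ => f m).symm

/-! ### The charge of a set of integers -/

/-- The set `A` of integers has charge `c`: it arises from the set of negative integers by adding
finitely many elements and removing finitely many, `c` more being added than removed. As `ℤ` is
discrete, convergence of the sum already says that only finitely many terms are nonzero. -/
def HasCharge (A : Set ℤ) (c : ℤ) : Prop :=
  HasSum (fun x : ℤ => A.indicator (1 : ℤ → ℤ) x - (Set.Iio 0).indicator 1 x) c

theorem HasCharge.unique {A : Set ℤ} {c d : ℤ} (hc : HasCharge A c) (hd : HasCharge A d) : c = d :=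
  HasSum.unique hc hd

theorem hasCharge_insert_iff {A : Set ℤ} {b c : ℤ} (hb : b ∉ A) :
    HasCharge (insert b A) (c + 1) ↔ HasCharge A c := by
  have hsingle : ((insert b A).indicator 1 : ℤ → ℤ) = A.indicator 1 + Pi.single b 1 := by
    ext x
    by_cases hx : x = b
    · simp [hx, hb]
    · by_cases hA : x ∈ A <;> simp [hx, hA]
  have hone : HasSum (Pi.single b (1 : ℤ)) 1 := hasSum_pi_single b 1
  simp only [HasCharge, hsingle, Pi.add_apply, add_sub_right_comm]
  exact ⟨fun h => by simpa using h.sub hone, fun h => h.add hone⟩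

theorem hasCharge_move_iff {A : Set ℤ} {a b c : ℤ} (ha : a ∈ A) (hb : b ∉ A) :
    HasCharge (insert b (A \ {a})) c ↔ HasCharge A c := by
  have hA : insert a (A \ {a}) = A := Set.insert_sdiff_self_of_mem ha
  rw [← sub_add_cancel c 1, hasCharge_insert_iff fun h => hb h.1, ← hasCharge_insert_iff (b := a),
    hA]
  exact fun h => h.2 rfl

theorem hasCharge_Iio (p : ℤ) : HasCharge (Set.Iio p) p := by
  have hsucc (p : ℤ) : HasCharge (Set.Iio (p + 1)) (p + 1) ↔ HasCharge (Set.Iio p) p := by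
    have hinsert : Set.Iio (p + 1) = insert p (Set.Iio p) := by
      ext x
      simp only [Set.mem_Iio, Set.mem_insert_iff]
      omega
    rw [hinsert, hasCharge_insert_iff (by simp)]
  induction p using Int.induction_on with
  | zero => simp [HasCharge]
  | succ i ih => rwa [hsucc]
  | pred i ih => rwa [← hsucc, sub_add_cancel]

theorem hasCharge_finset_union_Iio {T : Finset ℤ} {m : ℤ} (hT : ∀ x ∈ T, m ≤ x) :
    HasCharge (↑T ∪ Set.Iio m) (T.card + m) := by
  induction T using Finset.induction_on with
  | empty => simpa using hasCharge_Iio m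
  | insert a T ha ih =>
    rw [Finset.forall_mem_insert] at hT
    have hnot : a ∉ ↑T ∪ Set.Iio m := by simp [ha, hT.1]
    rw [Finset.card_insert_of_notMem ha, Finset.coe_insert, Set.insert_union, Nat.cast_add_one,
      add_right_comm, hasCharge_insert_iff hnot]
    exact ih hT.2

theorem HasCharge.exists_bound {A : Set ℤ} {c : ℤ} (h : HasCharge A c) :
    ∃ M : ℕ, (∀ x ∈ A, x < M) ∧ ∀ x : ℤ, x < -M → x ∈ A := by
  have hfin := h.summable.hasFiniteSupport_of_discreteTopology
  obtain ⟨u, hu⟩ := hfin.bddAbove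
  obtain ⟨l, hl⟩ := hfin.bddBelow
  have hmem {x : ℤ} (hx : ¬ (x ∈ A ↔ x < 0)) : l ≤ x ∧ x ≤ u := by
    have hsupp : x ∈ Function.support fun x : ℤ =>
        A.indicator (1 : ℤ → ℤ) x - (Set.Iio 0).indicator 1 x := by
      by_cases hA : x ∈ A <;> by_cases h0 : x < 0 <;> simp_all
    exact ⟨hl hsupp, hu hsupp⟩
  refine ⟨u.natAbs + l.natAbs + 1, fun x hx => ?_, fun x hx => ?_⟩
  · by_contra! hle
    have := hmem (x := x) (by simp only [hx, true_iff]; omega)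
    omega
  · by_contra hA
    have := hmem (x := x) (by simp only [hA, false_iff]; omega)
    omega

theorem HasCharge.image {w : Equiv.Perm ℤ} {A : Set ℤ} {c d : ℤ} (h : HasCharge A c)
    (hw : HasCharge (w '' Set.Iio 0) d) : HasCharge (w '' A) (c + d) := by
  have hind (B : Set ℤ) : ((w '' B).indicator 1 : ℤ → ℤ) = B.indicator 1 ∘ w.symm := by
    rw [Equiv.image_eq_preimage_symm]
    rfl
  have hpull : HasSum (fun x : ℤ => (w '' A).indicator (1 : ℤ → ℤ) x -
      (w '' Set.Iio 0).indicator 1 x) c := by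
    rw [hind, hind]
    exact w.symm.hasSum_iff.2 h
  simpa [HasCharge] using hpull.add hw

theorem hasSum_indicator_neg_sub {s : ℕ} (hs : 0 < s) (a : ℤ) :
    HasSum (fun u : ℤ => (Set.Iio 0).indicator 1 u - (Set.Iio 0).indicator 1 (a + s * u))
      (a / s) := by
  have hneg (u : ℤ) : a + s * u < 0 ↔ u < -(a / s) := by
    have hs' : (0 : ℤ) < s := by exact_mod_cast hs
    rw [lt_neg, Int.ediv_lt_iff_lt_mul hs']
    constructor <;> intro h <;> linarith
  simpa [Set.indicator_apply, hneg] using (hasCharge_Iio (-(a / s))).neg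

theorem sum_ediv_of_modEq {s : ℕ} (hs : 0 < s) {g : ℤ → ℤ}
    (hg : ∀ a b, g a ≡ g b [ZMOD s] → a ≡ b [ZMOD s]) {c : ℤ}
    (hsum : ∑ m ∈ Finset.range s, g m = s.choose 2 + s * c) :
    ∑ m ∈ Finset.range s, g m / s = c := by
  have hmod : ∑ m ∈ Finset.range s, g m % s = s.choose 2 := by
    rw [sum_range_comp_of_modEq hg (f := (· % (s : ℤ))) fun m => Int.add_emod_right m s,
      ← sum_range_cast]
    refine Finset.sum_congr rfl fun m hm => ?_
    exact Int.emod_eq_of_lt (by omega) (by exact_mod_cast Finset.mem_range.1 hm)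
  have hdiv : ∑ m ∈ Finset.range s, g m = s * ∑ m ∈ Finset.range s, g m / s + s.choose 2 := by
    rw [← hmod, Finset.mul_sum, ← Finset.sum_add_distrib]
    exact Finset.sum_congr rfl fun m _ => (Int.mul_ediv_add_emod _ _).symm
  have hs' : (s : ℤ) ≠ 0 := by exact_mod_cast hs.ne'
  exact mul_left_cancel₀ hs' (by linarith)

-- Each residue class contains exactly one of `g 0, …, g (s - 1)` and, seen from there, `A` looks
-- like the set of negative integers: the class of `g m` contributes the quotient `g m / s`.
theorem hasCharge_of_transversal {s : ℕ} (hs : 0 < s) {g : ℤ → ℤ}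
    (hg : ∀ a b, g a ≡ g b [ZMOD s] → a ≡ b [ZMOD s]) {A : Set ℤ}
    (hA : ∀ m < s, ∀ u : ℤ, g m + s * u ∈ A ↔ u < 0) {c : ℤ}
    (hsum : ∑ m ∈ Finset.range s, g m = s.choose 2 + s * c) : HasCharge A c := by
  classical
  have hs' : (s : ℤ) ≠ 0 := by exact_mod_cast hs.ne'
  set F : ℤ → ℤ := fun x => A.indicator 1 x - (Set.Iio 0).indicator 1 x with hF
  have hsplit : F = fun x => ∑ m ∈ Finset.range s, if (s : ℤ) ∣ g m - x then F x else 0 := by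
    ext x
    rw [sum_range_comp_of_modEq hg (f := fun k => if (s : ℤ) ∣ k - x then F x else 0),
      sum_range_ite_dvd hs]
    intro k
    simp only [add_sub_right_comm, dvd_add_self_right]
  rw [HasCharge, ← hF, hsplit, ← sum_ediv_of_modEq hs hg hsum]
  refine hasSum_sum fun m hm => ?_
  have hinj : Function.Injective fun u : ℤ => g m + s * u := fun a b hab =>
    mul_left_cancel₀ hs' (add_left_cancel hab)
  rw [← hinj.hasSum_iff]
  · refine (hasSum_indicator_neg_sub hs (g m)).congr_fun fun u => ?_
    simp [hF, Set.indicator_apply, hA m (Finset.mem_range.1 hm)]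
  · intro x hx
    refine if_neg fun ⟨k, hk⟩ => hx ⟨-k, ?_⟩
    change g m + s * (-k) = x
    linarith

theorem hasCharge_image_affineSym {s : ℕ} (hs : 0 < s) (w : AffineSym s) {A : Set ℤ} {c : ℤ}
    (h : HasCharge A c) : HasCharge ((w : Equiv.Perm ℤ) '' A) c := by
  have hadd := equivariant_add_mul (w : Equiv.Perm ℤ) w.2.1
  have hreflect (a b : ℤ) (hab : (w : Equiv.Perm ℤ) a ≡ (w : Equiv.Perm ℤ) b [ZMOD s]) :
      a ≡ b [ZMOD s] := by
    obtain ⟨k, hk⟩ := Int.modEq_iff_dvd.1 hab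
    refine Int.modEq_iff_dvd.2 ⟨k, ?_⟩
    have : b = a + s * k := (w : Equiv.Perm ℤ).injective (by rw [hadd]; linarith)
    linarith
  have hneg : HasCharge ((w : Equiv.Perm ℤ) '' Set.Iio 0) 0 := by
    refine hasCharge_of_transversal hs hreflect (fun m hm u => ?_) (by rw [w.2.2]; ring)
    rw [← hadd, (w : Equiv.Perm ℤ).injective.mem_set_image, Set.mem_Iio]
    have : (m : ℤ) < s := by exact_mod_cast hm
    constructor <;> intro hu
    · by_contra! hle
      have := mul_nonneg (show (0 : ℤ) ≤ s by omega) hle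
      omega
    · have : (s : ℤ) * u ≤ s * (-1) := mul_le_mul_of_nonneg_left (by omega) (by omega)
      omega
  simpa using h.image hneg

/-! ### Beta-sets are the sets of charge zero -/

theorem betaSet_eq_image_union_Iio (la : YoungDiagram) :
    betaSet la =
      ↑((Finset.range (la.colLen 0)).image (bead la)) ∪ Set.Iio (-(la.colLen 0 : ℤ)) := by
  rw [Finset.coe_image, Finset.coe_range]
  apply Set.Subset.antisymm
  · rintro _ ⟨i, rfl⟩
    rcases lt_or_ge i (la.colLen 0) with hi | hi
    · exact Or.inl ⟨i, hi, rfl⟩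
    · refine Or.inr ?_
      change bead la i < _
      rw [bead_eq_of_colLen_le hi]
      omega
  · rintro x (⟨i, -, rfl⟩ | hx)
    · exact bead_mem_betaSet la i
    · rw [Set.mem_Iio] at hx
      exact ⟨(-x - 1).toNat, (bead_eq_of_colLen_le (by omega)).trans (by omega)⟩

theorem hasCharge_betaSet (la : YoungDiagram) : HasCharge (betaSet la) 0 := by
  have hge : ∀ x ∈ (Finset.range (la.colLen 0)).image (bead la), -(la.colLen 0 : ℤ) ≤ x := by
    simp only [Finset.mem_image, Finset.mem_range, bead]
    rintro _ ⟨i, hi, rfl⟩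
    omega
  have h := hasCharge_finset_union_Iio hge
  rwa [← betaSet_eq_image_union_Iio,
    Finset.card_image_of_injective _ (bead_strictAnti la).injective, Finset.card_range,
    add_neg_cancel] at h

theorem exists_youngDiagram_rowLen_eq {f : ℕ → ℕ} (hf : Antitone f) {M : ℕ}
    (hM : ∀ i, M ≤ i → f i = 0) : ∃ la : YoungDiagram, ∀ i, la.rowLen i = f i := by
  have hsorted : ((List.range M).map f).SortedGE := by
    refine List.Pairwise.sortedGE (List.pairwise_map.2 ?_)
    exact List.pairwise_lt_range.imp fun h => hf h.le
  refine ⟨YoungDiagram.ofRowLens _ hsorted, fun i => eq_of_forall_lt_iff fun k => ?_⟩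
  rw [← YoungDiagram.mem_iff_lt_rowLen, YoungDiagram.mem_ofRowLens]
  rcases lt_or_ge i M with hi | hi
  · simp [hi]
  · simp [hM i hi, hi]

theorem exists_bead_eq {b : ℕ → ℤ} (hb : StrictAnti b) {M : ℕ}
    (hM : ∀ i, M ≤ i → b i = -(i + 1)) : ∃ la, bead la = b := by
  have hanti : Antitone fun i : ℕ => b i + i + 1 := by
    refine antitone_nat_of_succ_le fun i => ?_
    have := hb (Nat.lt_add_one i)
    push_cast
    omega
  have hnonneg (i : ℕ) : 0 ≤ b i + i + 1 := by
    have := hanti (Nat.le_max_left i M)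
    simp only [hM _ (Nat.le_max_right i M)] at this
    omega
  obtain ⟨la, hla⟩ := exists_youngDiagram_rowLen_eq (f := fun i => (b i + i + 1).toNat)
    (fun i j hij => Int.toNat_le_toNat (hanti hij)) (M := M)
    fun i hi => by rw [hM i hi]; omega
  refine ⟨la, funext fun i => ?_⟩
  have := hnonneg i
  rw [bead, hla]
  omega

theorem exists_strictAnti_range_eq {T : Finset ℤ} (hT : ∀ x ∈ T, -(T.card : ℤ) ≤ x) :
    ∃ b : ℕ → ℤ, StrictAnti b ∧ (∀ i, T.card ≤ i → b i = -(i + 1)) ∧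
      Set.range b = ↑T ∪ Set.Iio (-(T.card : ℤ)) := by
  let e := T.orderEmbOfFin rfl
  let b (i : ℕ) : ℤ := if h : i < T.card then e (Fin.rev ⟨i, h⟩) else -(i + 1)
  have hlt {i : ℕ} (hi : i < T.card) : b i = e (Fin.rev ⟨i, hi⟩) := dif_pos hi
  have hge {i : ℕ} (hi : T.card ≤ i) : b i = -(i + 1) := dif_neg hi.not_gt
  have hmem {i : ℕ} (hi : i < T.card) : b i ∈ T := hlt hi ▸ T.orderEmbOfFin_mem rfl _
  refine ⟨b, fun i j hij => ?_, fun i => hge, Set.Subset.antisymm ?_ ?_⟩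
  · rcases lt_or_ge j T.card with hj | hj
    · rw [hlt hj, hlt (hij.trans hj)]
      exact e.strictMono (Fin.rev_lt_rev.2 hij)
    · rw [hge hj]
      rcases lt_or_ge i T.card with hi | hi
      · have := hT _ (hmem hi)
        omega
      · rw [hge hi]
        omega
  · rintro _ ⟨i, rfl⟩
    rcases lt_or_ge i T.card with hi | hi
    · exact Or.inl (hmem hi)
    · rw [hge hi]
      exact Or.inr (Set.mem_Iio.2 (by omega))
  · rintro x (hx | hx)
    · obtain ⟨k, rfl⟩ : x ∈ Set.range e := by rwa [T.range_orderEmbOfFin]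
      exact ⟨k.rev, by rw [hlt k.rev.is_lt, Fin.eta, Fin.rev_rev]⟩
    · rw [Set.mem_Iio] at hx
      exact ⟨(-x - 1).toNat, by rw [hge (by omega)]; omega⟩

theorem HasCharge.exists_betaSet_eq {A : Set ℤ} (hA : HasCharge A 0) : ∃ la, betaSet la = A := by
  classical
  obtain ⟨M, hupper, hlower⟩ := hA.exists_bound
  set T : Finset ℤ := (Finset.Ico (-(M : ℤ)) M).filter (· ∈ A) with hT
  have hmemT (x : ℤ) (hx : x ∈ T) : -(M : ℤ) ≤ x := (Finset.mem_Ico.1 (Finset.mem_filter.1 hx).1).1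
  have hTA : (T : Set ℤ) ∪ Set.Iio (-(M : ℤ)) = A := by
    ext x
    have := hupper x
    have := hlower x
    simp only [hT, Set.mem_union, Finset.mem_coe, Finset.mem_filter, Finset.mem_Ico, Set.mem_Iio]
    grind
  have hcard : T.card = M := by
    have := hasCharge_finset_union_Iio hmemT
    rw [hTA] at this
    have := this.unique hA
    omega
  obtain ⟨b, hb, hbM, hrange⟩ := exists_strictAnti_range_eq (T := T) (by rwa [hcard])
  obtain ⟨la, rfl⟩ := exists_bead_eq hb hbM
  exact ⟨la, by rw [← hTA, ← hcard, ← hrange]; rfl⟩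

/-! ### Level `t` coordinates -/

/-- The integer with level `t` coordinates `(i, v)`. The index `i` determines its class modulo `s`,
and the level `t` action permutes indices; `(i + s, v)` and `(i, v + t)` are coordinates of the same
integer. -/
def levelPos (s t : ℕ) (i v : ℤ) : ℤ := i * t - halfProd s t + s * v

theorem levelPos_add_right (s t : ℕ) (i v u : ℤ) :
    levelPos s t i (v + u) = levelPos s t i v + s * u := by
  simp only [levelPos]
  ring

theorem levelPos_add_mul_left (s t : ℕ) (i v k : ℤ) :
    levelPos s t (i + s * k) v = levelPos s t i (v + t * k) := by
  simp only [levelPos]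
  ring

theorem levelPos_sub_one_left (s t : ℕ) (i v : ℤ) :
    levelPos s t (i - 1) v = levelPos s t i v - t := by
  simp only [levelPos]
  ring

theorem levelPos_strictMono {s : ℕ} (hs : 0 < s) (t : ℕ) (i : ℤ) :
    StrictMono (levelPos s t i) := fun _ _ h =>
  add_lt_add_right (mul_lt_mul_of_pos_left h (Int.natCast_pos.2 hs)) _

theorem exists_levelPos_eq {s t : ℕ} (h : s.Coprime t) (x : ℤ) :
    ∃ v, levelPos s t (levelIndex s t x) v = x := by
  obtain ⟨v, hv⟩ := Int.modEq_iff_dvd.1 (levelIndex_mul h x)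
  exact ⟨v, by rw [levelPos]; linarith⟩

theorem modEq_of_levelPos_modEq {s t : ℕ} (h : s.Coprime t) {i j u v : ℤ}
    (hij : levelPos s t i u ≡ levelPos s t j v [ZMOD s]) : i ≡ j [ZMOD s] := by
  have hpos (k x : ℤ) : levelPos s t k x ≡ k * t - halfProd s t [ZMOD s] :=
    Int.modEq_iff_dvd.2 ⟨-x, by rw [levelPos]; ring⟩
  apply modEq_of_mul_modEq h
  simpa using ((hpos i u).symm.trans (hij.trans (hpos j v))).add_right (halfProd s t)

theorem levelIndex_levelPos {s t : ℕ} (h : s.Coprime t) (i v : ℤ) :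
    levelIndex s t (levelPos s t i v) ≡ i [ZMOD s] := by
  obtain ⟨u, hu⟩ := exists_levelPos_eq h (levelPos s t i v)
  exact modEq_of_levelPos_modEq h (congrArg (· % (s : ℤ)) hu)

theorem levelAction_levelPos {s t : ℕ} (h : s.Coprime t) (w : AffineSym s) (i v : ℤ) :
    levelAction s t h w (levelPos s t i v) = levelPos s t ((w : Equiv.Perm ℤ) i) v := by
  change levelFun s t w (levelPos s t i v) = _
  rw [levelFun, displacement_congr w (levelIndex_levelPos h i v)]
  simp only [levelPos]
  ring

theorem two_mul_halfProd {s t : ℕ} (hs : 0 < s) (ht : 0 < t) (h : s.Coprime t) :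
    2 * halfProd s t = ((s : ℤ) - 1) * (t - 1) := by
  have heven : 2 ∣ (s - 1) * (t - 1) := by
    by_contra hodd
    rw [Nat.two_dvd_ne_zero, ← Nat.odd_iff, Nat.odd_mul, Nat.odd_iff, Nat.odd_iff] at hodd
    have : 2 ∣ s.gcd t := Nat.dvd_gcd (by omega) (by omega)
    rw [h] at this
    omega
  rw [halfProd, ← Nat.cast_ofNat (R := ℤ), ← Nat.cast_mul, Nat.mul_div_cancel' heven, Nat.cast_mul,
    Nat.cast_sub hs, Nat.cast_sub ht, Nat.cast_one]

theorem sum_levelPos {s t : ℕ} (hs : 0 < s) (ht : 0 < t) (h : s.Coprime t) (y : ℤ → ℤ) :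
    ∑ i ∈ Finset.range s, levelPos s t i (y i) = s.choose 2 + s * ∑ i ∈ Finset.range s, y i := by
  simp only [levelPos, Finset.sum_add_distrib, Finset.sum_sub_distrib, ← Finset.mul_sum,
    ← Finset.sum_mul, sum_range_cast, Finset.sum_const, Finset.card_range, nsmul_eq_mul]
  have hchoose : 2 * (s.choose 2 : ℤ) = s * (s - 1) := by
    rw [Nat.choose_two_right, ← Nat.cast_ofNat (R := ℤ), ← Nat.cast_mul,
      Nat.mul_div_cancel' (Nat.even_mul_pred_self s).two_dvd, Nat.cast_mul, Nat.cast_sub hs,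
      Nat.cast_one]
  have htwice : 2 * ((s.choose 2 : ℤ) * t - s * halfProd s t) = 2 * s.choose 2 := by
    linear_combination (t - 1 : ℤ) * hchoose - s * two_mul_halfProd hs ht h
  linarith

/-! ### Profiles of cores -/

/-- `y` is the profile of the set `A`: in the coordinates `levelPos`, the set `A` is the region
strictly below the graph of `y`. -/
def IsProfile (s t : ℕ) (A : Set ℤ) (y : ℤ → ℤ) : Prop :=
  ∀ i v, levelPos s t i v ∈ A ↔ v < y i

/-- The sequences that are profiles of beta-sets of `s`-cores, see `exists_isProfile` and
`IsCoreProfile.exists_isProfile`. -/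
structure IsCoreProfile (s t : ℕ) (y : ℤ → ℤ) : Prop where
  map_add : ∀ i, y (i + s) = y i - t
  sum_eq_zero : ∑ i ∈ Finset.range s, y i = 0

theorem map_add_mul_of_map_add {s t : ℕ} {y : ℤ → ℤ} (hy : ∀ i, y (i + s) = y i - t) (i k : ℤ) :
    y (i + s * k) = y i - t * k := by
  have hperiodic : ∀ m, s * y (m + s) + t * (m + s) = s * y m + t * m := fun m => by rw [hy]; ring
  rcases s.eq_zero_or_pos with rfl | hs
  · have ht : (t : ℤ) = 0 := by simpa using (hy i).symm
    simp [ht]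
  · have := periodic_add_mul (fun m => s * y m + t * m) hperiodic k i
    exact mul_left_cancel₀ (Int.natCast_ne_zero.2 hs.ne') (by linarith)

theorem periodic_levelPos {s t : ℕ} {y : ℤ → ℤ} (hy : ∀ i, y (i + s) = y i - t) :
    Function.Periodic (fun i => levelPos s t i (y i)) (s : ℤ) := fun i => by
  simp only [hy, levelPos]
  ring

namespace IsProfile

variable {s t : ℕ} {A B : Set ℤ} {y z : ℤ → ℤ}

theorem unique (hy : IsProfile s t A y) (hz : IsProfile s t A z) : y = z :=
  funext fun i => eq_of_forall_lt_iff fun v => (hy i v).symm.trans (hz i v)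

theorem set_unique (h : s.Coprime t) (hA : IsProfile s t A y) (hB : IsProfile s t B y) : A = B := by
  ext x
  obtain ⟨v, hv⟩ := exists_levelPos_eq h x
  rw [← hv, hA, hB]

theorem map_add (hy : IsProfile s t A y) (i : ℤ) : y (i + s) = y i - t := by
  refine eq_of_forall_lt_iff fun v => ?_
  have hpos := levelPos_add_mul_left s t i v 1
  rw [mul_one, mul_one] at hpos
  rw [← hy, hpos, hy, lt_sub_iff_add_lt]

theorem image (h : s.Coprime t) (hy : IsProfile s t A y) (w : AffineSym s) :
    IsProfile s t (levelAction s t h w '' A) (y ∘ (w⁻¹ : AffineSym s)) := by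
  intro i v
  have hpos : levelAction s t h w (levelPos s t ((w⁻¹ : Equiv.Perm ℤ) i) v) = levelPos s t i v :=
    (levelAction_levelPos h w _ v).trans
      (congrArg (levelPos s t · v) ((w : Equiv.Perm ℤ).apply_symm_apply i))
  rw [← hpos, (Equiv.injective _).mem_set_image]
  exact hy _ v

theorem hasCharge (hs : 0 < s) (ht : 0 < t) (h : s.Coprime t) (hy : IsProfile s t A y) :
    HasCharge A (∑ i ∈ Finset.range s, y i) :=
  hasCharge_of_transversal hs (g := fun i => levelPos s t i (y i))
    (fun _ _ => modEq_of_levelPos_modEq h)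
    (fun i _ u => by rw [← levelPos_add_right, hy, add_lt_iff_neg_left])
    (sum_levelPos hs ht h y)

theorem isCore (hs : 0 < s) (h : s.Coprime t) {la : YoungDiagram}
    (hy : IsProfile s t (betaSet la) y) : IsCore s la := by
  rw [isCore_iff hs]
  intro b hb
  obtain ⟨v, hv⟩ := exists_levelPos_eq h b
  have hsub : b - s = levelPos s t (levelIndex s t b) (v + -1) := by
    rw [levelPos_add_right, hv]
    ring
  rw [← hv, hy] at hb
  rw [hsub, hy]
  omega

theorem isCoreProfile (hs : 0 < s) (ht : 0 < t) (h : s.Coprime t) {la : YoungDiagram}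
    (hy : IsProfile s t (betaSet la) y) : IsCoreProfile s t y :=
  ⟨hy.map_add, (hy.hasCharge hs ht h).unique (hasCharge_betaSet la)⟩

theorem isCore_iff_antitone (ht : 0 < t) (h : s.Coprime t) {la : YoungDiagram}
    (hy : IsProfile s t (betaSet la) y) : IsCore t la ↔ Antitone y := by
  rw [isCore_iff ht]
  constructor
  · intro hcore
    refine antitone_int_of_succ_le fun i => ?_
    by_contra! hlt
    have hmem := hcore _ ((hy (i + 1) (y i)).2 hlt)
    rw [← levelPos_sub_one_left, hy, add_sub_cancel_right] at hmem
    exact lt_irrefl _ hmem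
  · intro hanti b hb
    obtain ⟨v, hv⟩ := exists_levelPos_eq h b
    rw [← hv, hy] at hb
    rw [← hv, ← levelPos_sub_one_left, hy]
    exact hb.trans_le (hanti (sub_one_lt _).le)

end IsProfile

theorem exists_preimage_betaSet_eq_Iio {f : ℤ → ℤ} (hf : StrictMono f) {la : YoungDiagram}
    (hpred : ∀ i, f i ∈ betaSet la → f (i - 1) ∈ betaSet la) :
    ∃ p, f ⁻¹' betaSet la = Set.Iio p := by
  obtain ⟨M, hupper, hlower⟩ := (hasCharge_betaSet la).exists_bound
  have hmono : Monotone fun i => f i - i := monotone_int_of_le_succ fun i => by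
    have := hf (lt_add_one i)
    omega
  have hanti : Antitone fun i => f i ∈ betaSet la := antitone_int_of_succ_le fun i hi => by
    simpa using hpred _ hi
  have hmem : f (min 0 (-M - f 0 - 1)) ∈ betaSet la := hlower _ (by
    have := hmono (min_le_left 0 (-M - f 0 - 1))
    dsimp only at this
    omega)
  have hbdd : ∀ i, f i ∈ betaSet la → i ≤ max 0 (M - f 0) := fun i hi => by
    by_contra! hlt
    have := hmono (max_lt_iff.1 hlt).1.le
    have := hupper _ hi
    dsimp only at *
    omega
  obtain ⟨m, hm, hmax⟩ := Int.exists_greatest_of_bdd ⟨_, hbdd⟩ ⟨_, hmem⟩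
  refine ⟨m + 1, Set.ext fun i => ?_⟩
  rw [Set.mem_Iio, Int.lt_add_one_iff]
  exact ⟨hmax i, fun hi => hanti hi hm⟩

theorem exists_isProfile {s : ℕ} (hs : 0 < s) (t : ℕ) {la : YoungDiagram} (hla : IsCore s la) :
    ∃ y, IsProfile s t (betaSet la) y := by
  have hIio (i : ℤ) : ∃ p, levelPos s t i ⁻¹' betaSet la = Set.Iio p := by
    refine exists_preimage_betaSet_eq_Iio (levelPos_strictMono hs t i) fun v hv => ?_
    have hpos : levelPos s t i (v - 1) = levelPos s t i v - s := by
      rw [sub_eq_add_neg, levelPos_add_right]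
      ring
    rw [hpos]
    exact (isCore_iff hs la).1 hla _ hv
  choose y hy using hIio
  exact ⟨y, fun i v => Set.ext_iff.1 (hy i) v⟩

namespace IsCoreProfile

variable {s t : ℕ} {y : ℤ → ℤ}

theorem exists_isProfile (hs : 0 < s) (ht : 0 < t) (h : s.Coprime t) (hy : IsCoreProfile s t y) :
    ∃ la, IsProfile s t (betaSet la) y := by
  have hprofile : IsProfile s t {x | ∃ i v, v < y i ∧ levelPos s t i v = x} y := by
    refine fun i v => ⟨?_, fun hv => ⟨i, v, hv, rfl⟩⟩
    rintro ⟨j, u, hu, hx⟩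
    have hji := modEq_of_levelPos_modEq h (congrArg (· % (s : ℤ)) hx)
    have hbound := levelPos_strictMono hs t j hu
    rw [hx, eq_of_modEq_of_periodic (periodic_levelPos hy.map_add) hji] at hbound
    exact (levelPos_strictMono hs t i).lt_iff_lt.1 hbound
  have hcharge := hprofile.hasCharge hs ht h
  rw [hy.sum_eq_zero] at hcharge
  obtain ⟨la, hla⟩ := hcharge.exists_betaSet_eq
  exact ⟨la, hla ▸ hprofile⟩

theorem comp (hs : 0 < s) (hy : IsCoreProfile s t y) (w : AffineSym s) :
    IsCoreProfile s t (y ∘ (w : Equiv.Perm ℤ)) := by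
  refine ⟨fun i => by simp only [Function.comp_apply, w.2.1 i, hy.map_add], ?_⟩
  have hsum := sum_range_comp_of_periodic (w : Equiv.Perm ℤ) w.2.1 (fun i => s * y i + t * i)
    (fun i => by rw [hy.map_add]; ring)
  simp only [Finset.sum_add_distrib, ← Finset.mul_sum, hy.sum_eq_zero, w.2.2,
    sum_range_cast] at hsum
  exact (mul_eq_zero.1 (add_eq_right.1 (hsum.trans (by ring)))).resolve_left
    (Int.natCast_ne_zero.2 hs.ne')

end IsCoreProfile

/-! ### `s`-sets in level `t` coordinates -/

/-- The condition on the profile of an `s`-core that its `s`-set has spread less than `N s`, see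
`IsProfile.smallSpread_iff`. -/
def SmallSpread (s t N : ℕ) (y : ℤ → ℤ) : Prop :=
  ∀ i j, levelPos s t i (y i) - levelPos s t j (y j) < N * s

theorem levelPos_sub_levelPos (s t : ℕ) (i u v : ℤ) :
    levelPos s t i u - levelPos s t i v = (u - v) * s := by
  simp only [levelPos]
  ring

theorem levelPos_modEq_iff {s : ℕ} (hs : 0 < s) (t N : ℕ) (i u v : ℤ) :
    levelPos s t i u ≡ levelPos s t i v [ZMOD ((N * s : ℕ) : ℤ)] ↔ u ≡ v [ZMOD N] := by
  rw [Int.modEq_iff_dvd, Int.modEq_iff_dvd, levelPos_sub_levelPos, Nat.cast_mul,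
    mul_dvd_mul_iff_right (Int.natCast_ne_zero.2 hs.ne')]

namespace IsProfile

variable {s t : ℕ} {la mu : YoungDiagram} {y z : ℤ → ℤ}

theorem levelPos_eq_of_modEq {A : Set ℤ} (hy : IsProfile s t A y) {i j : ℤ} (h : i ≡ j [ZMOD s]) :
    levelPos s t i (y i) = levelPos s t j (y j) :=
  eq_of_modEq_of_periodic (periodic_levelPos hy.map_add) h

theorem isLeast_levelPos (hs : 0 < s) (hy : IsProfile s t (betaSet la) y) (i : ℤ) :
    IsLeast {b | b ≡ levelPos s t i (y i) [ZMOD s] ∧ b ∉ betaSet la} (levelPos s t i (y i)) := by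
  refine ⟨⟨Int.ModEq.rfl, fun hmem => lt_irrefl _ ((hy _ _).1 hmem)⟩, ?_⟩
  rintro b ⟨hmod, hb⟩
  obtain ⟨k, hk⟩ := Int.modEq_iff_dvd.1 hmod.symm
  obtain rfl : b = levelPos s t i (y i + k) := by
    rw [levelPos_add_right]
    linarith
  rw [hy, not_lt] at hb
  exact (levelPos_strictMono hs t i).monotone hb

theorem sSet_eq_range (hs : 0 < s) (h : s.Coprime t) (hy : IsProfile s t (betaSet la) y) :
    sSet s la = Set.range fun i => levelPos s t i (y i) := by
  refine Set.Subset.antisymm (fun x hx => ?_) (Set.range_subset_iff.2 (hy.isLeast_levelPos hs))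
  obtain ⟨v, hv⟩ := exists_levelPos_eq h x
  set i := levelIndex s t x
  have hmod : levelPos s t i (y i) ≡ x [ZMOD s] := by
    simpa [hv] using (levelPos_modEq_iff hs t 1 i (y i) v).2 Int.modEq_one
  have hleast := hy.isLeast_levelPos hs i
  exact ⟨i, le_antisymm (hleast.2 ⟨hmod.symm, hx.1.2⟩) (hx.2 ⟨hmod, hleast.1.2⟩)⟩

theorem levelPos_levelIndex (hs : 0 < s) (h : s.Coprime t) (hy : IsProfile s t (betaSet la) y)
    {x : ℤ} (hx : x ∈ sSet s la) : levelPos s t (levelIndex s t x) (y (levelIndex s t x)) = x := by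
  rw [hy.sSet_eq_range hs h] at hx
  obtain ⟨i, rfl⟩ := hx
  exact hy.levelPos_eq_of_modEq (levelIndex_levelPos h i _)

theorem smallSpread_iff {N : ℕ} (hs : 0 < s) (h : s.Coprime t)
    (hy : IsProfile s t (betaSet la) y) :
    (∀ k ∈ sSet s la, ∀ l ∈ sSet s la, k - l < N * s) ↔ SmallSpread s t N y := by
  simp only [hy.sSet_eq_range hs h, Set.forall_mem_range, SmallSpread]

/-- The bijection between the `s`-sets of two cores that preserves residues modulo `s`. -/
def sSetEquiv (hs : 0 < s) (h : s.Coprime t) (hy : IsProfile s t (betaSet la) y)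
    (hz : IsProfile s t (betaSet mu) z) : sSet s la ≃ sSet s mu where
  toFun k := ⟨levelPos s t (levelIndex s t k) (z (levelIndex s t k)), hz.isLeast_levelPos hs _⟩
  invFun k := ⟨levelPos s t (levelIndex s t k) (y (levelIndex s t k)), hy.isLeast_levelPos hs _⟩
  left_inv k := Subtype.ext <| (hy.levelPos_eq_of_modEq (levelIndex_levelPos h _ _)).trans
    (hy.levelPos_levelIndex hs h k.2)
  right_inv k := Subtype.ext <| (hz.levelPos_eq_of_modEq (levelIndex_levelPos h _ _)).trans
    (hz.levelPos_levelIndex hs h k.2)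

theorem coreCongr_iff {N : ℕ} (hs : 0 < s) (h : s.Coprime t) (hy : IsProfile s t (betaSet la) y)
    (hz : IsProfile s t (betaSet mu) z) : CoreCongr s N la mu ↔ ∀ i, y i ≡ z i [ZMOD N] := by
  constructor
  · rintro ⟨f, hf⟩ i
    have hcongr := hf ⟨_, hy.isLeast_levelPos hs i⟩
    rw [← hz.levelPos_levelIndex hs h (f _).2] at hcongr
    have hindex := modEq_of_levelPos_modEq h (hcongr.of_dvd (by simp))
    rw [hz.levelPos_eq_of_modEq hindex, levelPos_modEq_iff hs] at hcongr
    exact hcongr.symm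
  · intro hyz
    refine ⟨hy.sSetEquiv hs h hz, fun k => ?_⟩
    have hk := hy.levelPos_levelIndex hs h k.2
    conv_rhs => rw [← hk]
    exact (levelPos_modEq_iff hs t N _ _ _).2 (hyz _).symm

end IsProfile

/-! ### Profiles in a congruence class -/

/-- The group of `s`-periodic integer sequences whose sum over a period vanishes: the translation
lattice of the affine symmetric group. -/
def zeroSumPeriodic (s : ℕ) : AddSubgroup (ℤ → ℤ) where
  carrier := {q | Function.Periodic q (s : ℤ) ∧ ∑ i ∈ Finset.range s, q i = 0}
  zero_mem' := ⟨fun _ => rfl, by simp⟩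
  add_mem' hp hq := ⟨hp.1.add hq.1, by
    simp only [Pi.add_apply, Finset.sum_add_distrib, hp.2, hq.2, add_zero]⟩
  neg_mem' hq := ⟨fun i => congrArg Neg.neg (hq.1 i), by
    simp only [Pi.neg_apply, Finset.sum_neg_distrib, hq.2, neg_zero]⟩

theorem eq_of_periodic_of_forall_lt {α : Type*} {s : ℕ} (hs : 0 < s) {f g : ℤ → α}
    (hf : Function.Periodic f (s : ℤ)) (hg : Function.Periodic g (s : ℤ))
    (h : ∀ k < s, f k = g k) : f = g := by
  funext i
  have hs' : (0 : ℤ) < s := Int.natCast_pos.2 hs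
  obtain ⟨k, hk⟩ := Int.eq_ofNat_of_zero_le (Int.emod_nonneg i hs'.ne')
  have hmod : i ≡ k [ZMOD s] := hk ▸ (Int.mod_modEq i s).symm
  rw [eq_of_modEq_of_periodic hf hmod, eq_of_modEq_of_periodic hg hmod]
  have := Int.emod_lt_of_pos i hs'
  exact h k (by omega)

theorem exists_pos_of_mem_zeroSumPeriodic {s : ℕ} (hs : 0 < s) {q : ℤ → ℤ}
    (hq : q ∈ zeroSumPeriodic s) (hne : q ≠ 0) : ∃ i, 0 < q i := by
  have hnonzero : ∃ k ∈ Finset.range s, q (k : ℕ) ≠ 0 := by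
    by_contra! hzero
    exact hne (eq_of_periodic_of_forall_lt hs hq.1 (fun _ => rfl)
      fun k hk => hzero k (Finset.mem_range.2 hk))
  obtain ⟨k, -, hk⟩ := Finset.exists_pos_of_sum_zero_of_exists_nonzero _ hq.2 hnonzero
  exact ⟨k, hk⟩

theorem IsCoreProfile.add_smul {s t : ℕ} {y q : ℤ → ℤ} (hy : IsCoreProfile s t y)
    (hq : q ∈ zeroSumPeriodic s) (c : ℤ) : IsCoreProfile s t (y + c • q) where
  map_add i := by
    simp only [Pi.add_apply, Pi.smul_apply, hy.map_add, hq.1 i]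
    ring
  sum_eq_zero := by
    simp only [Pi.add_apply, Pi.smul_apply, Finset.sum_add_distrib, ← Finset.smul_sum, hq.2,
      hy.sum_eq_zero, smul_zero, add_zero]

theorem IsCoreProfile.exists_eq_add_smul {s t N : ℕ} (hN : 0 < N) {y z : ℤ → ℤ}
    (hy : IsCoreProfile s t y) (hz : IsCoreProfile s t z) (h : ∀ i, y i ≡ z i [ZMOD N]) :
    ∃ q ∈ zeroSumPeriodic s, z = y + (N : ℤ) • q := by
  choose q hq using fun i => Int.modEq_iff_dvd.1 (h i)
  have hN' : (N : ℤ) ≠ 0 := Int.natCast_ne_zero.2 hN.ne'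
  refine ⟨q, ⟨fun i => mul_left_cancel₀ hN' ?_, mul_left_cancel₀ hN' ?_⟩, funext fun i => ?_⟩
  · rw [← hq, ← hq, hy.map_add, hz.map_add]
    ring
  · rw [Finset.mul_sum, mul_zero]
    simp only [← hq, Finset.sum_sub_distrib, hy.sum_eq_zero, hz.sum_eq_zero, sub_zero]
  · rw [Pi.add_apply, Pi.smul_apply, smul_eq_mul, ← hq]
    ring

theorem SmallSpread.eq_of_modEq {s t N : ℕ} (hs : 0 < s) (hN : 0 < N) {y z : ℤ → ℤ}
    (hy : IsCoreProfile s t y) (hz : IsCoreProfile s t z) (hy' : SmallSpread s t N y)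
    (hz' : SmallSpread s t N z) (h : ∀ i, y i ≡ z i [ZMOD N]) : y = z := by
  obtain ⟨q, hq, rfl⟩ := hy.exists_eq_add_smul hN hz h
  suffices hzero : q = 0 by rw [hzero, smul_zero, add_zero]
  by_contra hne
  obtain ⟨i, hi⟩ := exists_pos_of_mem_zeroSumPeriodic hs hq hne
  obtain ⟨j, hj⟩ := exists_pos_of_mem_zeroSumPeriodic hs (neg_mem hq) (neg_ne_zero.2 hne)
  rw [Pi.neg_apply, neg_pos] at hj
  have hspread := add_lt_add (hz' i j) (hy' j i)
  simp only [Pi.add_apply, Pi.smul_apply, smul_eq_mul, levelPos_add_right] at hspread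
  have hgap : (N * s : ℤ) * 2 ≤ N * s * (q i - q j) :=
    mul_le_mul_of_nonneg_left (by omega) (by positivity)
  linarith

theorem smallSpread_of_antitone {s t N : ℕ} (hs : 0 < s) (ht : 0 < t) (hN : t ≤ N) {y : ℤ → ℤ}
    (hy : IsCoreProfile s t y) (hanti : Antitone y) : SmallSpread s t N y := by
  intro i j
  have hs' : (0 : ℤ) < s := Int.natCast_pos.2 hs
  set d := (i - j) % s
  have hd : 0 ≤ d := Int.emod_nonneg _ hs'.ne'
  have hi : i ≡ j + d [ZMOD s] := by simpa using (Int.mod_modEq (i - j) s).symm.add_left j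
  have hpos : levelPos s t i (y i) = levelPos s t (j + d) (y (j + d)) :=
    eq_of_modEq_of_periodic (periodic_levelPos hy.map_add) hi
  have hy_le : (s : ℤ) * y (j + d) ≤ s * y j :=
    mul_le_mul_of_nonneg_left (hanti (by omega)) hs'.le
  have hd_lt : d * t < s * t := mul_lt_mul_of_pos_right (Int.emod_lt_of_pos _ hs') (by simpa)
  have hst : (s : ℤ) * t ≤ s * N := mul_le_mul_of_nonneg_left (by exact_mod_cast hN) hs'.le
  rw [hpos]
  simp only [levelPos]
  linarith

/-! ### Representatives of minimal energy -/

/-- The sequence that is `1` on the class of `a` modulo `s`, `-1` on the class of `b`, and `0`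
elsewhere (identically `0` when these classes agree). -/
def exchange (s : ℕ) (a b k : ℤ) : ℤ :=
  (if (s : ℤ) ∣ k - a then 1 else 0) - if (s : ℤ) ∣ k - b then 1 else 0

theorem periodic_exchange (s : ℕ) (a b : ℤ) : Function.Periodic (exchange s a b) (s : ℤ) := by
  intro k
  have hdvd (c : ℤ) : (s : ℤ) ∣ k + s - c ↔ (s : ℤ) ∣ k - c := by
    rw [add_sub_right_comm, dvd_add_self_right]
  simp only [exchange, hdvd]

theorem sum_exchange_mul {s : ℕ} (hs : 0 < s) (a b : ℤ) {f : ℤ → ℤ}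
    (hf : Function.Periodic f (s : ℤ)) :
    ∑ k ∈ Finset.range s, exchange s a b k * f k = f a - f b := by
  have hindicator (c : ℤ) (k : ℕ) : (if (s : ℤ) ∣ (k : ℤ) - c then 1 else 0) * f k =
      if (s : ℤ) ∣ (k : ℤ) - c then f c else 0 := by
    split_ifs with hdvd
    · rw [one_mul, eq_of_modEq_of_periodic hf (Int.modEq_iff_dvd.2 hdvd)]
    · rw [zero_mul]
  simp only [exchange, sub_mul, hindicator, Finset.sum_sub_distrib, sum_range_ite_dvd hs]

theorem exchange_mem_zeroSumPeriodic {s : ℕ} (hs : 0 < s) (a b : ℤ) :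
    exchange s a b ∈ zeroSumPeriodic s := by
  refine ⟨periodic_exchange s a b, ?_⟩
  have hsum := sum_exchange_mul hs a b (f := fun _ => 1) fun _ => rfl
  simpa only [mul_one, sub_self] using hsum

theorem sum_sq_add_exchange {s : ℕ} (hs : 0 < s) {a b : ℤ} (hab : ¬ a ≡ b [ZMOD s]) {f : ℤ → ℤ}
    (hf : Function.Periodic f (s : ℤ)) (c : ℤ) :
    ∑ k ∈ Finset.range s, (f k + c * exchange s a b k) ^ 2 =
      ∑ k ∈ Finset.range s, f k ^ 2 + 2 * c * (f a - f b + c) := by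
  have ha : exchange s a b a = 1 := by
    simp [exchange, mt (fun hdvd => (Int.modEq_iff_dvd.2 hdvd).symm) hab]
  have hb : exchange s a b b = -1 := by
    simp [exchange, mt Int.modEq_iff_dvd.2 hab]
  have hsq := sum_exchange_mul hs a b (periodic_exchange s a b)
  rw [ha, hb] at hsq
  have hexpand (k : ℤ) : (f k + c * exchange s a b k) ^ 2 =
      f k ^ 2 + 2 * c * (exchange s a b k * f k) +
        c ^ 2 * (exchange s a b k * exchange s a b k) := by
    ring
  simp only [hexpand, Finset.sum_add_distrib, ← Finset.mul_sum, sum_exchange_mul hs a b hf, hsq]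
  ring

/-- The sum of the squares of the elements of the `s`-set of the core with profile `y`. -/
def energy (s t : ℕ) (y : ℤ → ℤ) : ℤ := ∑ k ∈ Finset.range s, levelPos s t k (y k) ^ 2

theorem exists_forall_energy_le (s t : ℕ) {Y : Set (ℤ → ℤ)} (hY : Y.Nonempty) :
    ∃ y ∈ Y, ∀ z ∈ Y, energy s t y ≤ energy s t z := by
  have hnonneg (y : ℤ → ℤ) : 0 ≤ energy s t y := Finset.sum_nonneg fun _ _ => sq_nonneg _
  obtain ⟨y, hy, hmin⟩ := (measure fun y => (energy s t y).toNat).wf.has_min Y hY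
  refine ⟨y, hy, fun z hz => ?_⟩
  have hle : ¬ (energy s t z).toNat < (energy s t y).toNat := hmin z hz
  have := hnonneg z
  omega

theorem IsCoreProfile.energy_add_exchange {s t : ℕ} (hs : 0 < s) {y : ℤ → ℤ}
    (hy : IsCoreProfile s t y) {a b : ℤ} (hab : ¬ a ≡ b [ZMOD s]) (c : ℤ) :
    energy s t (y + c • exchange s a b) = energy s t y +
      2 * (s * c) * (levelPos s t a (y a) - levelPos s t b (y b) + s * c) := by
  rw [energy, energy, ← sum_sq_add_exchange hs hab (periodic_levelPos hy.map_add)]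
  refine Finset.sum_congr rfl fun k _ => ?_
  rw [Pi.add_apply, Pi.smul_apply, levelPos_add_right, smul_eq_mul, mul_assoc]

theorem IsCoreProfile.exists_smallSpread {s t N : ℕ} (hs : 0 < s) (h : s.Coprime t) (hN : 0 < N)
    {y : ℤ → ℤ} (hy : IsCoreProfile s t y) :
    ∃ z, IsCoreProfile s t z ∧ SmallSpread s t N z ∧ ∀ i, y i ≡ z i [ZMOD N] := by
  obtain ⟨z, ⟨hz, hyz⟩, hmin⟩ := exists_forall_energy_le s t
    (Y := {z | IsCoreProfile s t z ∧ ∀ i, y i ≡ z i [ZMOD N]}) ⟨y, hy, fun _ => Int.ModEq.rfl⟩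
  refine ⟨z, hz, fun i j => ?_, hyz⟩
  by_contra! hle
  have hNs : (0 : ℤ) < N * s := by positivity
  have hij : ¬ i ≡ j [ZMOD s] := fun hij => by
    have := eq_of_modEq_of_periodic (periodic_levelPos hz.map_add) hij
    linarith
  have hne : (N * s : ℤ) ≠ levelPos s t i (z i) - levelPos s t j (z j) := fun heq =>
    hij (modEq_of_levelPos_modEq h (Int.modEq_iff_dvd.2 (heq ▸ dvd_mul_left _ _)).symm)
  have hlt := lt_of_le_of_ne hle hne
  have henergy := hmin (z + (-N : ℤ) • exchange s i j)
    ⟨hz.add_smul (exchange_mem_zeroSumPeriodic hs i j) _, fun k => (hyz k).trans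
      (Int.modEq_iff_dvd.2 ⟨-exchange s i j k, by simp⟩)⟩
  rw [hz.energy_add_exchange hs hij] at henergy
  nlinarith

theorem coe_simpleReflection_apply {s : ℕ} (hs : 2 ≤ s) (i k : ℤ) :
    (simpleReflection s hs (i + 1) : Equiv.Perm ℤ) k = k + exchange s i (i + 1) k := by
  have hdvd (h : (s : ℤ) ∣ k - i) : ¬ (s : ℤ) ∣ k - (i + 1) := fun h' => by
    have := Int.le_of_dvd one_pos (by simpa using dvd_sub h h')
    omega
  rw [simpleReflection_apply, levelGenerator_one, add_sub_cancel_right, exchange]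
  split_ifs <;> first | tauto | ring

theorem IsCoreProfile.energy_comp_simpleReflection {s t : ℕ} (hs : 2 ≤ s) {y : ℤ → ℤ}
    (hy : IsCoreProfile s t y) (i : ℤ) :
    energy s t (y ∘ (simpleReflection s hs (i + 1) : Equiv.Perm ℤ)) =
      energy s t y + 2 * t * (s * (y i - y (i + 1))) := by
  set r : Equiv.Perm ℤ := (simpleReflection s hs (i + 1)).1 with hr
  have hinvolutive (k : ℤ) : r (r k) = k := levelGenerator_one_involutive hs (i + 1) k
  have hadd : ∀ k, r (k + s) = r k + s := (simpleReflection s hs (i + 1)).2.1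
  have hne : ¬ i ≡ i + 1 [ZMOD s] := fun h => by
    have := Int.le_of_dvd one_pos (by simpa using Int.modEq_iff_dvd.1 h)
    omega
  have hpos (k : ℤ) :
      levelPos s t (r k) (y k) = levelPos s t k (y k) + t * exchange s i (i + 1) k := by
    rw [hr, coe_simpleReflection_apply, levelPos, levelPos]
    ring
  have hdiff : levelPos s t i (y i) - levelPos s t (i + 1) (y (i + 1)) + t =
      s * (y i - y (i + 1)) := by
    simp only [levelPos]
    ring
  calc energy s t (y ∘ r) = ∑ k ∈ Finset.range s, levelPos s t (r (r k)) (y (r k)) ^ 2 := by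
        simp only [energy, hinvolutive, Function.comp_apply]
    _ = ∑ k ∈ Finset.range s, levelPos s t (r k) (y k) ^ 2 :=
        sum_range_comp_of_periodic r hadd (fun k => levelPos s t (r k) (y k) ^ 2) fun k => by
          simp only [hadd, hy.map_add, levelPos]
          ring
    _ = energy s t y + 2 * t * (s * (y i - y (i + 1))) := by
        simp only [hpos, energy]
        rw [sum_sq_add_exchange (by omega) hne (periodic_levelPos hy.map_add), hdiff]

theorem IsCoreProfile.exists_antitone_comp {s t : ℕ} (hs : 2 ≤ s) (ht : 0 < t) {y : ℤ → ℤ}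
    (hy : IsCoreProfile s t y) : ∃ w : AffineSym s, Antitone (y ∘ (w : Equiv.Perm ℤ)) := by
  obtain ⟨_, ⟨w, rfl⟩, hmin⟩ := exists_forall_energy_le s t
    (Set.range_nonempty fun w : AffineSym s => y ∘ (w : Equiv.Perm ℤ))
  refine ⟨w, antitone_int_of_succ_le fun i => ?_⟩
  by_contra! hlt
  have henergy : energy s t (y ∘ w) ≤
      energy s t (y ∘ (w * simpleReflection s hs (i + 1) : AffineSym s)) :=
    hmin _ ⟨w * simpleReflection s hs (i + 1), rfl⟩
  rw [Subgroup.coe_mul, Equiv.Perm.coe_mul, ← Function.comp_assoc,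
    (hy.comp (by omega) w).energy_comp_simpleReflection hs i] at henergy
  have : 0 < 2 * (t : ℤ) * (s * ((y ∘ (w : Equiv.Perm ℤ)) (i + 1) - (y ∘ (w : Equiv.Perm ℤ)) i)) :=
    mul_pos (by omega) (mul_pos (by omega) (sub_pos.2 hlt))
  linarith

/-! ### Runners and `t`-cores -/

/-- A runner of the abacus with `t` runners: the numbers `i` with `levelPos s t i v` in `A`, where
`levelPos s t · v` lists a residue class modulo `t`. -/
def runner (s t : ℕ) (A : Set ℤ) (v : ℤ) : Set ℤ := (levelPos s t · v) ⁻¹' A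

theorem levelPos_strictMono_left (s : ℕ) {t : ℕ} (ht : 0 < t) (v : ℤ) :
    StrictMono (levelPos s t · v) := fun _ _ h =>
  add_lt_add_left (sub_lt_sub_right (mul_lt_mul_of_pos_right h (Int.natCast_pos.2 ht)) _) _

theorem runner_insert_sub {s t : ℕ} (ht : 0 < t) (A : Set ℤ) (i v : ℤ) :
    runner s t (insert (levelPos s t i v - t) (A \ {levelPos s t i v})) v =
      insert (i - 1) (runner s t A v \ {i}) := by
  have hinj := (levelPos_strictMono_left s ht v).injective
  ext j
  rw [← levelPos_sub_one_left]
  simp only [runner, Set.mem_preimage, Set.mem_insert_iff, Set.mem_sdiff, Set.mem_singleton_iff,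
    hinj.eq_iff]

theorem runner_insert_sub_of_forall_ne {s t : ℕ} (A : Set ℤ) {b v : ℤ}
    (hb : ∀ i, levelPos s t i v ≠ b) :
    runner s t (insert (b - t) (A \ {b})) v = runner s t A v := by
  ext j
  have hne : levelPos s t j v ≠ b - t := fun hj => hb (j + 1) <| by
    rw [← sub_left_inj (a := (t : ℤ)), ← hj, ← levelPos_sub_one_left, add_sub_cancel_right]
  simp only [runner, Set.mem_preimage, Set.mem_insert_iff, Set.mem_sdiff, Set.mem_singleton_iff,
    hne, hb j, false_or, not_false_eq_true, and_true]

theorem RemovesRimHook.hasCharge_runner_iff {t : ℕ} (s : ℕ) (ht : 0 < t) {la mu : YoungDiagram}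
    (h : RemovesRimHook t la mu) (v c : ℤ) :
    HasCharge (runner s t (betaSet mu) v) c ↔ HasCharge (runner s t (betaSet la) v) c := by
  obtain ⟨b, hb, hb', hmu⟩ := h.exists_betaSet_eq
  rw [hmu]
  by_cases hi : ∃ i, levelPos s t i v = b
  · obtain ⟨i, rfl⟩ := hi
    rw [runner_insert_sub ht]
    exact hasCharge_move_iff hb (by rwa [runner, Set.mem_preimage, levelPos_sub_one_left])
  · rw [runner_insert_sub_of_forall_ne _ (not_exists.1 hi)]

theorem IsCoreOf.hasCharge_runner_iff {t : ℕ} (s : ℕ) (ht : 0 < t) {la mu : YoungDiagram}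
    (h : IsCoreOf t mu la) (v c : ℤ) :
    HasCharge (runner s t (betaSet mu) v) c ↔ HasCharge (runner s t (betaSet la) v) c := by
  obtain ⟨-, h⟩ := h
  induction h with
  | refl => rfl
  | tail _ hremove ih => rw [hremove.hasCharge_runner_iff s ht, ih]

theorem IsCore.exists_runner_eq_Iio (s : ℕ) {t : ℕ} (ht : 0 < t) {la : YoungDiagram}
    (h : IsCore t la) (v : ℤ) : ∃ p, runner s t (betaSet la) v = Set.Iio p :=
  exists_preimage_betaSet_eq_Iio (levelPos_strictMono_left s ht v) fun i hi => by
    rw [levelPos_sub_one_left]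
    exact (isCore_iff ht la).1 h _ hi

theorem IsCore.eq_of_hasCharge_runner {s t : ℕ} (ht : 0 < t) (hst : s.Coprime t)
    {la mu : YoungDiagram} (hla : IsCore t la) (hmu : IsCore t mu)
    (h : ∀ v c, HasCharge (runner s t (betaSet la) v) c →
      HasCharge (runner s t (betaSet mu) v) c) : la = mu := by
  have hrunner (v : ℤ) : runner s t (betaSet la) v = runner s t (betaSet mu) v := by
    obtain ⟨p, hp⟩ := hla.exists_runner_eq_Iio s ht v
    obtain ⟨q, hq⟩ := hmu.exists_runner_eq_Iio s ht v
    have hcharge := h v p (hp ▸ hasCharge_Iio p)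
    rw [hq] at hcharge
    rw [hp, hq, hcharge.unique (hasCharge_Iio q)]
  apply betaSet_injective
  ext x
  obtain ⟨v, hv⟩ := exists_levelPos_eq hst x
  rw [← hv]
  exact Set.ext_iff.1 (hrunner v) (levelIndex s t x)

theorem IsProfile.hasCharge_runner_comp {s t : ℕ} (hs : 0 < s) {A B : Set ℤ} {y : ℤ → ℤ}
    {w : AffineSym s} (hy : IsProfile s t A y)
    (hyw : IsProfile s t B (y ∘ (w : Equiv.Perm ℤ))) {v c : ℤ}
    (h : HasCharge (runner s t A v) c) : HasCharge (runner s t B v) c := by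
  have hpreimage : runner s t B v = (w : Equiv.Perm ℤ) ⁻¹' runner s t A v :=
    Set.ext fun i => (hyw i v).trans (hy _ v).symm
  rw [hpreimage, ← Equiv.image_symm_eq_preimage]
  exact hasCharge_image_affineSym hs w⁻¹ h

theorem IsCoreOf.eq_of_isProfile_comp {s t : ℕ} (hs : 0 < s) (ht : 0 < t) (h : s.Coprime t)
    {la mu nu : YoungDiagram} {y : ℤ → ℤ} {w : AffineSym s} (hnu : IsCoreOf t nu la)
    (hmu : IsCore t mu) (hy : IsProfile s t (betaSet la) y)
    (hyw : IsProfile s t (betaSet mu) (y ∘ (w : Equiv.Perm ℤ))) : nu = mu :=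
  hnu.1.eq_of_hasCharge_runner ht h hmu fun v c hc =>
    hy.hasCharge_runner_comp hs hyw ((hnu.hasCharge_runner_iff s ht v c).1 hc)

/-! ### Congruence subgroups -/

/-- The elements of the affine symmetric group that act trivially modulo `n s`. For `n = 1` these
are the translations. -/
def congrSubgroup (s n : ℕ) : Subgroup (AffineSym s) where
  carrier := {w | ∀ i, (w : Equiv.Perm ℤ) i ≡ i [ZMOD n * s]}
  one_mem' := fun _ => Int.ModEq.rfl
  mul_mem' := fun {_ w} hv hw i => (hv ((w : Equiv.Perm ℤ) i)).trans (hw i)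
  inv_mem' := fun {w} hw i => by
    have h := hw ((w⁻¹ : Equiv.Perm ℤ) i)
    rw [show (w : Equiv.Perm ℤ) ((w⁻¹ : Equiv.Perm ℤ) i) = i from
      (w : Equiv.Perm ℤ).apply_symm_apply i] at h
    exact h.symm

theorem mem_congrSubgroup_iff_exists {s n : ℕ} {w : AffineSym s} :
    w ∈ congrSubgroup s n ↔ ∀ i, ∃ k, (w : Equiv.Perm ℤ) i = i + s * (n * k) := by
  refine forall_congr' fun i => ?_
  rw [Int.modEq_comm, Int.modEq_iff_dvd]
  exact exists_congr fun k => by rw [sub_eq_iff_eq_add', mul_assoc, mul_left_comm]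

theorem modEq_apply_of_modEq {s : ℕ} (n : ℕ) (w : AffineSym s) {a b : ℤ}
    (h : a ≡ b [ZMOD n * s]) : (w : Equiv.Perm ℤ) a ≡ (w : Equiv.Perm ℤ) b [ZMOD n * s] := by
  have hdisp := displacement_congr w (h.of_dvd (dvd_mul_left _ _))
  rw [Int.modEq_iff_dvd] at h ⊢
  rwa [show (w : Equiv.Perm ℤ) b - (w : Equiv.Perm ℤ) a = b - a by linarith]

instance congrSubgroup_normal (s n : ℕ) : (congrSubgroup s n).Normal where
  conj_mem := fun v hv w i => by
    have h := modEq_apply_of_modEq n w (hv ((w⁻¹ : Equiv.Perm ℤ) i))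
    rw [show (w : Equiv.Perm ℤ) ((w⁻¹ : Equiv.Perm ℤ) i) = i from
      (w : Equiv.Perm ℤ).apply_symm_apply i] at h
    exact h

theorem congrSubgroup_le (s n : ℕ) : congrSubgroup s n ≤ congrSubgroup s 1 := fun _ hw i =>
  (hw i).of_dvd (by simp)

theorem intCast_apply_eq_of_intCast_eq {s : ℕ} (w : AffineSym s) {a b : ℤ}
    (h : (a : ZMod s) = b) :
    (((w : Equiv.Perm ℤ) a : ℤ) : ZMod s) = ((w : Equiv.Perm ℤ) b : ℤ) := by
  rw [ZMod.intCast_eq_intCast_iff] at h ⊢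
  simpa using modEq_apply_of_modEq 1 w (by simpa using h)

/-- The action of the affine symmetric group on the residue classes modulo `s`. -/
def classAction (s : ℕ) : AffineSym s →* Equiv.Perm (ZMod s) :=
  MonoidHom.toHomPerm
    { toFun := fun w x => ((w : Equiv.Perm ℤ) x.cast : ℤ)
      map_one' := funext ZMod.intCast_zmod_cast
      map_mul' := fun v _ => funext fun _ =>
        intCast_apply_eq_of_intCast_eq v (ZMod.intCast_zmod_cast _).symm }

theorem classAction_intCast {s : ℕ} (w : AffineSym s) (m : ℤ) :
    classAction s w m = ((w : Equiv.Perm ℤ) m : ℤ) :=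
  intCast_apply_eq_of_intCast_eq w (ZMod.intCast_zmod_cast _)

theorem ker_classAction (s : ℕ) : (classAction s).ker = congrSubgroup s 1 := by
  ext w
  simp only [MonoidHom.mem_ker, Equiv.ext_iff, ZMod.intCast_surjective.forall, classAction_intCast,
    Equiv.Perm.one_apply, ZMod.intCast_eq_intCast_iff, congrSubgroup, Nat.cast_one, one_mul,
    Subgroup.mem_mk, Submonoid.mem_mk, Subsemigroup.mem_mk, Set.mem_ofPred_eq]

/-- The underlying function of `liftPerm`. -/
def liftPermFun {s : ℕ} (σ : Equiv.Perm (ZMod s)) (m : ℤ) : ℤ :=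
  m + ((σ m).cast - (m : ZMod s).cast)

theorem intCast_liftPermFun {s : ℕ} (σ : Equiv.Perm (ZMod s)) (m : ℤ) :
    (liftPermFun σ m : ZMod s) = σ m := by
  simp [liftPermFun]

theorem liftPermFun_mul {s : ℕ} (σ τ : Equiv.Perm (ZMod s)) (m : ℤ) :
    liftPermFun σ (liftPermFun τ m) = liftPermFun (σ * τ) m := by
  rw [liftPermFun, intCast_liftPermFun]
  simp only [liftPermFun, Equiv.Perm.mul_apply]
  ring

theorem liftPermFun_one {s : ℕ} (m : ℤ) : liftPermFun (1 : Equiv.Perm (ZMod s)) m = m := by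
  simp [liftPermFun]

theorem sum_range_intCast_zmod {s : ℕ} [NeZero s] {M : Type*} [AddCommMonoid M] (f : ZMod s → M) :
    ∑ m ∈ Finset.range s, f ((m : ℤ) : ZMod s) = ∑ x, f x := by
  refine Finset.sum_nbij' (fun m => ((m : ℤ) : ZMod s)) ZMod.val (by simp)
    (fun x _ => Finset.mem_range.2 x.val_lt) (fun m hm => ?_) (by simp) fun _ _ => rfl
  simpa using ZMod.val_cast_of_lt (Finset.mem_range.1 hm)

/-- The element of the affine symmetric group that acts on `0, …, s - 1` through a given
permutation of the residue classes modulo `s`. -/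
def liftPerm {s : ℕ} [NeZero s] (σ : Equiv.Perm (ZMod s)) : AffineSym s :=
  ⟨{ toFun := liftPermFun σ
     invFun := liftPermFun σ⁻¹
     left_inv := fun m => by rw [liftPermFun_mul, inv_mul_cancel, liftPermFun_one]
     right_inv := fun m => by rw [liftPermFun_mul, mul_inv_cancel, liftPermFun_one] },
    fun m => by simp [liftPermFun, add_right_comm], by
    simp only [Equiv.coe_fn_mk, liftPermFun, Finset.sum_add_distrib, Finset.sum_sub_distrib]
    rw [sum_range_intCast_zmod fun x => ((σ x).cast : ℤ),
      sum_range_intCast_zmod fun x => (x.cast : ℤ), Equiv.sum_comp σ fun x => (x.cast : ℤ),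
      sub_self, add_zero, sum_range_cast]⟩

theorem classAction_liftPerm {s : ℕ} [NeZero s] (σ : Equiv.Perm (ZMod s)) :
    classAction s (liftPerm σ) = σ := by
  ext x
  obtain ⟨m, rfl⟩ := ZMod.intCast_surjective x
  exact (classAction_intCast _ m).trans (intCast_liftPermFun σ m)

theorem index_congrSubgroup_one {s : ℕ} (hs : 0 < s) : (congrSubgroup s 1).index = s ! := by
  have : NeZero s := ⟨hs.ne'⟩
  have hsurj : Function.Surjective (classAction s) := fun σ => ⟨_, classAction_liftPerm σ⟩
  rw [← ker_classAction, Subgroup.index_ker, MonoidHom.range_eq_top.2 hsurj, Subgroup.card_top,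
    Nat.card_perm, Nat.card_zmod]

/-! ### Translations -/

/-- The translation `i ↦ i + s q(i)` of the affine symmetric group. -/
def translation (s : ℕ) : Multiplicative (zeroSumPeriodic s) →* AffineSym s where
  toFun q :=
    ⟨{ toFun := fun i => i + s * q.toAdd.1 i
       invFun := fun i => i - s * q.toAdd.1 i
       left_inv := fun i => by
         simp only [periodic_add_mul _ q.toAdd.2.1, add_sub_cancel_right]
       right_inv := fun i => by
         simp only [sub_eq_add_neg, ← mul_neg, periodic_add_mul _ q.toAdd.2.1]
         ring },
      fun i => by
        rw [Equiv.coe_fn_mk, q.toAdd.2.1, add_right_comm], by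
      simp only [Equiv.coe_fn_mk, Finset.sum_add_distrib, ← Finset.mul_sum, q.toAdd.2.2, mul_zero,
        add_zero, sum_range_cast]⟩
  map_one' := Subtype.ext <| Equiv.ext fun i => by simp
  map_mul' p q := Subtype.ext <| Equiv.ext fun i => by
    change i + s * (p.toAdd.1 i + q.toAdd.1 i) =
      i + s * q.toAdd.1 i + s * p.toAdd.1 (i + s * q.toAdd.1 i)
    rw [periodic_add_mul _ p.toAdd.2.1]
    ring

theorem translation_apply {s : ℕ} (q : Multiplicative (zeroSumPeriodic s)) (i : ℤ) :
    (translation s q : Equiv.Perm ℤ) i = i + s * q.toAdd.1 i := rfl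

theorem translation_mem_congrSubgroup_iff {s n : ℕ} (hs : 0 < s)
    {q : Multiplicative (zeroSumPeriodic s)} :
    translation s q ∈ congrSubgroup s n ↔ ∀ i, (n : ℤ) ∣ q.toAdd.1 i := by
  simp only [mem_congrSubgroup_iff_exists, translation_apply, add_right_inj,
    mul_right_inj' (Int.natCast_ne_zero.2 hs.ne'), dvd_def]

theorem range_translation {s : ℕ} (hs : 0 < s) : (translation s).range = congrSubgroup s 1 := by
  have hs' : (s : ℤ) ≠ 0 := Int.natCast_ne_zero.2 hs.ne'
  refine le_antisymm ?_ fun w hw => ?_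
  · rintro _ ⟨q, rfl⟩
    exact (translation_mem_congrSubgroup_iff hs).2 fun _ => by simp
  · choose q hq using mem_congrSubgroup_iff_exists.1 hw
    simp only [Nat.cast_one, one_mul] at hq
    have hperiodic : Function.Periodic q (s : ℤ) := fun i => mul_left_cancel₀ hs' <| by
      have hadd := w.2.1 i
      rw [hq, hq] at hadd
      linarith
    have hsum := w.2.2
    simp only [hq, Finset.sum_add_distrib, sum_range_cast, add_eq_left, ← Finset.mul_sum,
      mul_eq_zero, hs', false_or] at hsum
    exact ⟨Multiplicative.ofAdd ⟨q, hperiodic, hsum⟩,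
      Subtype.ext <| Equiv.ext fun i => (hq i).symm⟩

/-- The reduction modulo `n` of a zero-sum periodic sequence; the last coordinate is omitted, as it
is determined by the others. -/
def reduction (s n : ℕ) : zeroSumPeriodic s →+ (Fin (s - 1) → ZMod n) where
  toFun q i := (q.1 (i : ℕ) : ZMod n)
  map_zero' := by ext; simp
  map_add' _ _ := by ext; simp

theorem reduction_eq_zero_iff {s n : ℕ} (hs : 0 < s) {q : zeroSumPeriodic s} :
    reduction s n q = 0 ↔ ∀ i, (n : ℤ) ∣ q.1 i := by
  refine ⟨fun h => ?_, fun h => funext fun i => (ZMod.intCast_zmod_eq_zero_iff_dvd _ _).2 (h _)⟩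
  have hfirst : ∀ k < s - 1, (n : ℤ) ∣ q.1 k := fun k hk =>
    (ZMod.intCast_zmod_eq_zero_iff_dvd _ _).1 (congrFun h ⟨k, hk⟩)
  have hlast : (n : ℤ) ∣ q.1 (s - 1 : ℕ) := by
    have hsum := Finset.sum_range_succ (fun k : ℕ => q.1 k) (s - 1)
    rw [Nat.sub_add_cancel hs, q.2.2] at hsum
    rw [← dvd_add_right (Finset.dvd_sum fun k hk => hfirst k (Finset.mem_range.1 hk)), ← hsum]
    exact dvd_zero _
  have hperiodic : Function.Periodic (fun i => (n : ℤ) ∣ q.1 i) (s : ℤ) := fun i => by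
    simp only [q.2.1 i]
  have htrue := eq_of_periodic_of_forall_lt hs hperiodic (g := fun _ => True) (fun _ => rfl)
    fun k hk => eq_true <| by
      rcases eq_or_ne k (s - 1) with rfl | hne
      · exact hlast
      · exact hfirst k (by omega)
  exact fun i => of_eq_true (congrFun htrue i)

theorem exchange_natCast {s : ℕ} {a b k : ℕ} (ha : a < s) (hb : b < s) (hk : k < s) :
    exchange s a b k = (if k = a then 1 else 0) - if k = b then 1 else 0 := by
  have hdvd {c : ℕ} (hc : c < s) : (s : ℤ) ∣ (k : ℤ) - c ↔ k = c := by
    rw [← Int.modEq_iff_dvd, Int.natCast_modEq_iff, Nat.ModEq, Nat.mod_eq_of_lt hc,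
      Nat.mod_eq_of_lt hk, eq_comm]
  simp only [exchange, hdvd ha, hdvd hb]

theorem reduction_surjective {s : ℕ} (hs : 0 < s) (n : ℕ) :
    Function.Surjective (reduction s n) := by
  intro v
  choose u hu using fun i => ZMod.intCast_surjective (v i)
  refine ⟨∑ j : Fin (s - 1), u j • ⟨_, exchange_mem_zeroSumPeriodic hs (j : ℕ) (s - 1 : ℕ)⟩, ?_⟩
  ext i
  have hexchange (j : Fin (s - 1)) :
      exchange s (j : ℕ) (s - 1 : ℕ) (i : ℕ) = if i = j then 1 else 0 := by
    rw [exchange_natCast (by omega) (by omega) (by omega), if_neg i.2.ne, sub_zero]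
    simp only [Fin.ext_iff]
  simp [reduction, hexchange, hu]

theorem relIndex_congrSubgroup {s : ℕ} (hs : 0 < s) (n : ℕ) :
    (congrSubgroup s n).relIndex (congrSubgroup s 1) = n ^ (s - 1) := by
  have hker : (congrSubgroup s n).comap (translation s) =
      (AddMonoidHom.toMultiplicative (reduction s n)).ker := by
    ext q
    exact (translation_mem_congrSubgroup_iff hs).trans (reduction_eq_zero_iff hs).symm
  have hsurj : Function.Surjective (AddMonoidHom.toMultiplicative (reduction s n)) :=
    reduction_surjective hs n
  rw [← range_translation hs, ← Subgroup.index_comap, hker, Subgroup.index_ker,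
    MonoidHom.range_eq_top.2 hsurj, Subgroup.card_top, Nat.card_congr Multiplicative.toAdd,
    Nat.card_fun, Nat.card_zmod, Nat.card_fin]

theorem index_congrSubgroup {s : ℕ} (hs : 0 < s) (n : ℕ) :
    (congrSubgroup s n).index = n ^ (s - 1) * s ! := by
  rw [← Subgroup.relIndex_mul_index (congrSubgroup_le s n), relIndex_congrSubgroup hs,
    index_congrSubgroup_one hs]

namespace IsCoreProfile

variable {s t n : ℕ} {y z : ℤ → ℤ}

theorem comp_modEq_of_mem_congrSubgroup (hy : IsCoreProfile s t y) {w : AffineSym s}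
    (hw : w ∈ congrSubgroup s n) (i : ℤ) :
    y ((w : Equiv.Perm ℤ) i) ≡ y i [ZMOD ((n * t : ℕ) : ℤ)] := by
  obtain ⟨k, hk⟩ := mem_congrSubgroup_iff_exists.1 hw i
  rw [hk, map_add_mul_of_map_add hy.map_add, Int.modEq_iff_dvd, Nat.cast_mul]
  exact ⟨k, by ring⟩

theorem exists_comp_eq_of_modEq (hs : 0 < s) (hnt : 0 < n * t) (hy : IsCoreProfile s t y)
    (hz : IsCoreProfile s t z) (h : ∀ i, y i ≡ z i [ZMOD ((n * t : ℕ) : ℤ)]) :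
    ∃ w ∈ congrSubgroup s n, z = y ∘ (w : Equiv.Perm ℤ) := by
  obtain ⟨q, hq, rfl⟩ := hy.exists_eq_add_smul hnt hz h
  refine ⟨translation s (Multiplicative.ofAdd (-(n : ℤ) • ⟨q, hq⟩)),
    (translation_mem_congrSubgroup_iff hs).2 fun i => ⟨-q i, ?_⟩, funext fun i => ?_⟩
  · change -(n : ℤ) * q i = _
    ring
  · change y i + ((n * t : ℕ) : ℤ) * q i = y (i + s * (-(n : ℤ) * q i))
    rw [map_add_mul_of_map_add hy.map_add, Nat.cast_mul]
    ring

end IsCoreProfile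

/-! ### The level `t` actions on cores -/

theorem pos_of_coprime {s t : ℕ} (hs : 2 ≤ s) (h : s.Coprime t) : 0 < t := by
  rcases t.eq_zero_or_pos with rfl | ht
  · rw [Nat.coprime_zero_right] at h
    omega
  · exact ht

theorem isActionGraph_of_existsUnique {G X : Type*} [Group G] {R : G → X → X → Prop}
    (hR : ∀ g x, ∃! y, R g x y) (hone : ∀ x, R 1 x x)
    (hmul : ∀ g h x y z, R g x y → R h y z → R (h * g) x z) : IsActionGraph R := by
  choose f hf huniq using hR
  have hf_mul (g h : G) (x : X) : f h (f g x) = f (h * g) x :=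
    huniq _ _ _ (hmul _ _ _ _ _ (hf g x) (hf h _))
  have hf_one (x : X) : f 1 x = x := (huniq _ _ _ (hone x)).symm
  refine ⟨{ toFun := fun g => ⟨f g, f g⁻¹, fun x => by rw [hf_mul, inv_mul_cancel, hf_one],
              fun x => by rw [hf_mul, mul_inv_cancel, hf_one]⟩
            map_one' := Equiv.ext hf_one
            map_mul' := fun g h => Equiv.ext fun x => (hf_mul h g x).symm }, fun g x y => ?_⟩
  refine ⟨fun h => (huniq _ _ _ h).symm, ?_⟩
  rintro rfl
  exact hf g x

section Actions

variable {s t : ℕ} {y z : ℤ → ℤ} {w : AffineSym s}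

theorem actsOnCores_iff (h : s.Coprime t) {la mu : Cores s} (hy : IsProfile s t (betaSet la.1) y)
    (hz : IsProfile s t (betaSet mu.1) z) :
    ActsOnCores s t h w la mu ↔ z = y ∘ (w⁻¹ : AffineSym s) := by
  refine ⟨fun hact => ?_, ?_⟩
  · rw [ActsOnCores] at hact
    exact hz.unique (hact ▸ hy.image h w)
  · rintro rfl
    exact hz.set_unique h (hy.image h w)

theorem exists_actsOnCores (hs : 0 < s) (ht : 0 < t) (h : s.Coprime t) (w : AffineSym s)
    {la : Cores s} (hy : IsProfile s t (betaSet la.1) y) :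
    ∃ mu : Cores s, ActsOnCores s t h w la mu ∧
      IsProfile s t (betaSet mu.1) (y ∘ (w⁻¹ : AffineSym s)) := by
  obtain ⟨mu, hmu⟩ := ((hy.isCoreProfile hs ht h).comp hs w⁻¹).exists_isProfile hs ht h
  exact ⟨⟨mu, hmu.isCore hs h⟩, hmu.set_unique h (hy.image h w), hmu⟩

theorem ActsOnCores.unique {h : s.Coprime t} {la mu nu : Cores s}
    (hmu : ActsOnCores s t h w la mu) (hnu : ActsOnCores s t h w la nu) : mu = nu :=
  Subtype.ext (betaSet_injective (hmu.trans hnu.symm))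

theorem isActionGraph_actsOnCores (hs : 0 < s) (ht : 0 < t) (h : s.Coprime t) :
    IsActionGraph (ActsOnCores s t h) := by
  refine isActionGraph_of_existsUnique (fun w la => ?_) (fun la => ?_) fun v w la mu nu hv hw => ?_
  · obtain ⟨y, hy⟩ := exists_isProfile hs t la.2
    obtain ⟨mu, hmu, -⟩ := exists_actsOnCores hs ht h w hy
    exact ⟨mu, hmu, fun nu hnu => hnu.unique hmu⟩
  · simp [ActsOnCores]
  · rw [ActsOnCores] at hv hw ⊢
    rw [hw, hv, map_mul, Equiv.Perm.coe_mul, Set.image_comp]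

theorem BoundedCores.exists_isProfile {N : ℕ} (hs : 0 < s) (ht : 0 < t) (h : s.Coprime t)
    (la : BoundedCores s N) :
    ∃ y, IsProfile s t (betaSet la.1) y ∧ IsCoreProfile s t y ∧ SmallSpread s t N y := by
  obtain ⟨y, hy⟩ := _root_.exists_isProfile hs t la.2.1
  exact ⟨y, hy, hy.isCoreProfile hs ht h, (hy.smallSpread_iff hs h).1 la.2.2⟩

theorem SmallSpread.exists_boundedCore {N : ℕ} (hspread : SmallSpread s t N y) (hs : 0 < s)
    (ht : 0 < t) (h : s.Coprime t) (hy : IsCoreProfile s t y) :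
    ∃ la : BoundedCores s N, IsProfile s t (betaSet la.1) y := by
  obtain ⟨la, hla⟩ := hy.exists_isProfile hs ht h
  exact ⟨⟨la, hla.isCore hs h, (hla.smallSpread_iff hs h).2 hspread⟩, hla⟩

theorem BoundedCores.eq_of_modEq {N : ℕ} (hs : 0 < s) (ht : 0 < t) (h : s.Coprime t) (hN : 0 < N)
    {la mu : BoundedCores s N} (hy : IsProfile s t (betaSet la.1) y)
    (hz : IsProfile s t (betaSet mu.1) z) (hyz : ∀ i, y i ≡ z i [ZMOD N]) : la = mu := by
  obtain rfl : y = z := ((hy.smallSpread_iff hs h).1 la.2.2).eq_of_modEq hs hN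
    (hy.isCoreProfile hs ht h) (hz.isCoreProfile hs ht h) ((hz.smallSpread_iff hs h).1 mu.2.2) hyz
  exact Subtype.ext (betaSet_injective (hy.set_unique h hz))

theorem actsOnBoundedCores_iff {N : ℕ} (hs : 0 < s) (ht : 0 < t) (h : s.Coprime t)
    {la mu : BoundedCores s N} (hy : IsProfile s t (betaSet la.1) y)
    (hz : IsProfile s t (betaSet mu.1) z) :
    ActsOnBoundedCores s t N h w la mu ↔
      ∀ i, y (((w⁻¹ : AffineSym s) : Equiv.Perm ℤ) i) ≡ z i [ZMOD N] := by
  obtain ⟨ka, hact, hka⟩ := exists_actsOnCores hs ht h w (la := ⟨la.1, la.2.1⟩) hy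
  refine Iff.trans ⟨?_, fun hcongr => ⟨ka, hact, hcongr⟩⟩ (hka.coreCongr_iff hs h hz)
  rintro ⟨ka', hact', hcongr⟩
  rwa [hact.unique hact']

theorem isActionGraph_actsOnBoundedCores {N : ℕ} (hs : 0 < s) (ht : 0 < t) (h : s.Coprime t)
    (hN : 0 < N) : IsActionGraph (ActsOnBoundedCores s t N h) := by
  refine isActionGraph_of_existsUnique (fun w la => ?_) (fun la => ?_) fun v w la mu nu hv hw => ?_
  · obtain ⟨y, hy, hycore, -⟩ := la.exists_isProfile hs ht h
    obtain ⟨z, hzcore, hspread, hyz⟩ := (hycore.comp hs w⁻¹).exists_smallSpread hs h hN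
    obtain ⟨mu, hz⟩ := hspread.exists_boundedCore hs ht h hzcore
    refine ⟨mu, (actsOnBoundedCores_iff hs ht h hy hz).2 hyz, fun nu hnu => ?_⟩
    obtain ⟨x, hx, -, -⟩ := nu.exists_isProfile hs ht h
    have hyx := (actsOnBoundedCores_iff hs ht h hy hx).1 hnu
    exact BoundedCores.eq_of_modEq hs ht h hN hx hz fun i => (hyx i).symm.trans (hyz i)
  · obtain ⟨y, hy, -, -⟩ := la.exists_isProfile hs ht h
    exact (actsOnBoundedCores_iff hs ht h hy hy).2 fun i => Int.ModEq.rfl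
  · obtain ⟨y, hy, -, -⟩ := la.exists_isProfile hs ht h
    obtain ⟨z, hz, -, -⟩ := mu.exists_isProfile hs ht h
    obtain ⟨x, hx, -, -⟩ := nu.exists_isProfile hs ht h
    rw [actsOnBoundedCores_iff hs ht h hy hz] at hv
    rw [actsOnBoundedCores_iff hs ht h hz hx] at hw
    rw [actsOnBoundedCores_iff hs ht h hy hx, mul_inv_rev]
    exact fun i => (hv _).trans (hw i)

theorem IsCoreProfile.modEq_of_forall_lt {N : ℕ} (hs : 0 < s) (hy : IsCoreProfile s t y)
    (hz : IsCoreProfile s t z) (h : ∀ k < s, y k ≡ z k [ZMOD N]) (i : ℤ) : y i ≡ z i [ZMOD N] := by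
  have hperiodic : Function.Periodic (fun i => y i ≡ z i [ZMOD N]) (s : ℤ) := fun i => by
    simp only [hy.map_add, hz.map_add, Int.modEq_iff_dvd, sub_sub_sub_cancel_right]
  have htrue := eq_of_periodic_of_forall_lt hs hperiodic (g := fun _ => True) (fun _ => rfl)
    fun k hk => eq_true (h k hk)
  exact of_eq_true (congrFun htrue i)

theorem finite_boundedCores {N : ℕ} (hs : 0 < s) (ht : 0 < t) (h : s.Coprime t) (hN : 0 < N) :
    Finite (BoundedCores s N) := by
  have : NeZero N := ⟨hN.ne'⟩
  choose Y hprofile hcore _ using fun la : BoundedCores s N => la.exists_isProfile hs ht h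
  refine Finite.of_injective (β := Fin s → ZMod N) (fun la i => (Y la (i : ℕ) : ZMod N))
    fun la mu heq => BoundedCores.eq_of_modEq hs ht h hN (hprofile la) (hprofile mu) ?_
  exact (hcore la).modEq_of_forall_lt hs (hcore mu) fun k hk =>
    (ZMod.intCast_eq_intCast_iff _ _ _).1 (congrFun heq ⟨k, hk⟩)

theorem exists_boundedCore_of_isCore {N : ℕ} (hs : 0 < s) (ht : 0 < t) (h : s.Coprime t)
    (hN : t ≤ N) (mu : Cores s) (hmu : IsCore t mu.1) : ∃ nu : BoundedCores s N, nu.1 = mu.1 := by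
  obtain ⟨y, hy⟩ := exists_isProfile hs t mu.2
  have hspread := smallSpread_of_antitone hs ht hN (hy.isCoreProfile hs ht h)
    ((hy.isCore_iff_antitone ht h).1 hmu)
  exact ⟨⟨mu.1, mu.2, (hy.smallSpread_iff hs h).2 hspread⟩, rfl⟩

end Actions

/-! ### Stabilisers and orbits -/

/-- The stabiliser of a sequence under the action of the affine symmetric group on the indices. -/
def profileStabilizer (s : ℕ) (y : ℤ → ℤ) : Subgroup (AffineSym s) where
  carrier := {w | y ∘ (w : Equiv.Perm ℤ) = y}
  one_mem' := rfl
  mul_mem' := fun {_ w} hv hw => (congrArg (· ∘ (w : Equiv.Perm ℤ)) hv).trans hw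
  inv_mem' := fun {w} hw => ((w : Equiv.Perm ℤ).eq_comp_symm _ _).2 hw |>.symm

section Stabilizers

variable {s t n : ℕ} {y : ℤ → ℤ}

theorem coreStabilizer_eq (h : s.Coprime t) {la : Cores s} (hy : IsProfile s t (betaSet la.1) y) :
    coreStabilizer s t h la = (profileStabilizer s y : Set (AffineSym s)) := by
  ext w
  rw [SetLike.mem_coe, ← inv_mem_iff]
  exact (actsOnCores_iff h hy hy).trans eq_comm

theorem congrSubgroup_inf_profileStabilizer (ht : 0 < t) (n : ℕ) (hy : IsCoreProfile s t y) :
    congrSubgroup s n ⊓ profileStabilizer s y = ⊥ := by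
  refine eq_bot_iff.2 fun w ⟨hcongr, hstab⟩ => Subgroup.mem_bot.2 <| Subtype.ext <| Equiv.ext
    fun i => ?_
  obtain ⟨k, hk⟩ := mem_congrSubgroup_iff_exists.1 hcongr i
  have hyi : y ((w : Equiv.Perm ℤ) i) = y i := congrFun hstab i
  rw [hk, map_add_mul_of_map_add hy.map_add, sub_eq_self, mul_eq_zero,
    or_iff_right (Int.natCast_ne_zero.2 ht.ne')] at hyi
  rw [hk, hyi, mul_zero, add_zero]
  rfl

theorem card_profileStabilizer_mul_index (hs : 0 < s) (ht : 0 < t) (n : ℕ)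
    (hy : IsCoreProfile s t y) :
    Nat.card (profileStabilizer s y) * (congrSubgroup s n ⊔ profileStabilizer s y).index =
      n ^ (s - 1) * s ! := by
  rw [← index_congrSubgroup hs,
    ← Subgroup.relIndex_mul_index (le_sup_left : congrSubgroup s n ≤ _ ⊔ profileStabilizer s y),
    Subgroup.relIndex_sup_left, ← Subgroup.inf_relIndex_right,
    congrSubgroup_inf_profileStabilizer ht n hy, Subgroup.relIndex_bot_left]

theorem mem_congrSubgroup_sup_profileStabilizer (hs : 0 < s) (hnt : 0 < n * t)
    (hy : IsCoreProfile s t y) (w : AffineSym s) :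
    w ∈ congrSubgroup s n ⊔ profileStabilizer s y ↔
      ∀ i, y ((w : Equiv.Perm ℤ) i) ≡ y i [ZMOD ((n * t : ℕ) : ℤ)] := by
  rw [sup_comm, ← SetLike.mem_coe, Subgroup.mul_normal, Set.mem_mul]
  constructor
  · rintro ⟨v, hv, u, hu, rfl⟩ i
    have hyv : y ((v : Equiv.Perm ℤ) ((u : Equiv.Perm ℤ) i)) = y ((u : Equiv.Perm ℤ) i) :=
      congrFun hv _
    rw [Subgroup.coe_mul, Equiv.Perm.mul_apply, hyv]
    exact hy.comp_modEq_of_mem_congrSubgroup hu i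
  · intro hw
    obtain ⟨u, hu, hyu⟩ := (hy.comp hs w).exists_comp_eq_of_modEq hs hnt hy hw
    exact ⟨w * u, hyu.symm, u⁻¹, inv_mem hu, mul_inv_cancel_right w u⟩

theorem mem_boundedOrbit_iff (hs : 0 < s) (ht : 0 < t) (h : s.Coprime t) (hn : 0 < n)
    {la mu : BoundedCores s (n * t)} {z : ℤ → ℤ} (hy : IsProfile s t (betaSet la.1) y)
    (hz : IsProfile s t (betaSet mu.1) z) :
    mu ∈ boundedOrbit s t (n * t) h la ↔ ∃ w : AffineSym s, z = y ∘ (w : Equiv.Perm ℤ) := by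
  constructor
  · rintro ⟨w, hw⟩
    obtain ⟨v, -, rfl⟩ := ((hy.isCoreProfile hs ht h).comp hs w⁻¹).exists_comp_eq_of_modEq hs
      (Nat.mul_pos hn ht) (hz.isCoreProfile hs ht h) ((actsOnBoundedCores_iff hs ht h hy hz).1 hw)
    exact ⟨w⁻¹ * v, rfl⟩
  · rintro ⟨w, rfl⟩
    refine ⟨w⁻¹, (actsOnBoundedCores_iff hs ht h hy hz).2 fun i => ?_⟩
    rw [inv_inv, Function.comp_apply]

theorem ncard_boundedOrbit (hs : 0 < s) (ht : 0 < t) (h : s.Coprime t) (hn : 0 < n)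
    (la : BoundedCores s (n * t)) (hy : IsProfile s t (betaSet la.1) y) :
    (boundedOrbit s t (n * t) h la).ncard = (congrSubgroup s n ⊔ profileStabilizer s y).index := by
  have hnt : 0 < n * t := Nat.mul_pos hn ht
  obtain ⟨ρ, hρ⟩ := isActionGraph_actsOnBoundedCores hs ht h hnt
  let _ : MulAction (AffineSym s) (BoundedCores s (n * t)) := MulAction.compHom _ ρ
  have horbit : boundedOrbit s t (n * t) h la = MulAction.orbit (AffineSym s) la :=
    Set.ext fun mu => exists_congr fun w => hρ w la mu
  have hstab :
      MulAction.stabilizer (AffineSym s) la = congrSubgroup s n ⊔ profileStabilizer s y := by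
    ext w
    rw [← inv_mem_iff (x := w) (H := congrSubgroup s n ⊔ profileStabilizer s y),
      mem_congrSubgroup_sup_profileStabilizer hs hnt (hy.isCoreProfile hs ht h),
      ← actsOnBoundedCores_iff hs ht h hy hy, hρ]
    rfl
  rw [horbit, ← hstab, MulAction.index_stabilizer]

theorem ncard_boundedOrbit_mul_ncard_coreStabilizer (hs : 0 < s) (ht : 0 < t) (h : s.Coprime t)
    (hn : 0 < n) (la : BoundedCores s (n * t)) :
    (boundedOrbit s t (n * t) h la).ncard * (coreStabilizer s t h ⟨la.1, la.2.1⟩).ncard =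
      n ^ (s - 1) * s ! := by
  obtain ⟨y, hy, hycore, -⟩ := la.exists_isProfile hs ht h
  rw [ncard_boundedOrbit hs ht h hn la hy, coreStabilizer_eq (la := ⟨la.1, la.2.1⟩) h hy,
    ← card_profileStabilizer_mul_index hs ht n hycore, mul_comm, ← Nat.card_coe_set_eq]
  rfl

theorem exists_isCore_mem_boundedOrbit (hs : 2 ≤ s) (h : s.Coprime t) (hn : 0 < n)
    (la : BoundedCores s (n * t)) : ∃ mu ∈ boundedOrbit s t (n * t) h la, IsCore t mu.1 := by
  have hs0 : 0 < s := by omega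
  have ht := pos_of_coprime hs h
  obtain ⟨y, hy, hycore, -⟩ := la.exists_isProfile hs0 ht h
  obtain ⟨w, hanti⟩ := hycore.exists_antitone_comp hs ht
  have hspread :=
    smallSpread_of_antitone hs0 ht (Nat.le_mul_of_pos_left t hn) (hycore.comp hs0 w) hanti
  obtain ⟨mu, hmu⟩ := hspread.exists_boundedCore hs0 ht h (hycore.comp hs0 w)
  exact ⟨mu, (mem_boundedOrbit_iff hs0 ht h hn hy hmu).2 ⟨w, rfl⟩,
    (hmu.isCore_iff_antitone ht h).2 hanti⟩

theorem isCoreOf_iff_of_mem_boundedOrbit (hs : 0 < s) (ht : 0 < t) (h : s.Coprime t) (hn : 0 < n)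
    {la mu ka : BoundedCores s (n * t)} (hmu : mu ∈ boundedOrbit s t (n * t) h la)
    (hcore : IsCore t mu.1) (hka : ka ∈ boundedOrbit s t (n * t) h la) (nu : YoungDiagram) :
    IsCoreOf t nu ka.1 ↔ nu = mu.1 := by
  obtain ⟨y, hy, -, -⟩ := la.exists_isProfile hs ht h
  obtain ⟨z, hz, -, -⟩ := mu.exists_isProfile hs ht h
  obtain ⟨x, hx, -, -⟩ := ka.exists_isProfile hs ht h
  obtain ⟨w, rfl⟩ := (mem_boundedOrbit_iff hs ht h hn hy hz).1 hmu
  obtain ⟨v, rfl⟩ := (mem_boundedOrbit_iff hs ht h hn hy hx).1 hka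
  have hvw : y ∘ (w : Equiv.Perm ℤ) =
      (y ∘ (v : Equiv.Perm ℤ)) ∘ ((v⁻¹ * w : AffineSym s) : Equiv.Perm ℤ) :=
    funext fun i => congrArg y ((v : Equiv.Perm ℤ).apply_symm_apply _).symm
  have heq {nu : YoungDiagram} (hnu : IsCoreOf t nu ka.1) : nu = mu.1 :=
    hnu.eq_of_isProfile_comp hs ht h hcore hx (hvw ▸ hz)
  refine ⟨heq, ?_⟩
  rintro rfl
  obtain ⟨nu, hnu⟩ := exists_isCoreOf ht ka.1
  rwa [← heq hnu]

end Stabilizers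

theorem mainTheorem5 (s t n : ℕ) (hs : 2 ≤ s) (hst : s.Coprime t) (hn : 1 ≤ n) :
    -- the level `t` actions on all `s`-cores and on the bounded ones are well-defined actions
    IsActionGraph (ActsOnCores s t hst) ∧
    IsActionGraph (ActsOnBoundedCores s t (n * t) hst) ∧
    Finite (BoundedCores s (n * t)) ∧
    -- every `(s, t)`-core is bounded
    (∀ mu : Cores s, IsCore t mu.1 → ∃ nu : BoundedCores s (n * t), nu.1 = mu.1) ∧
    ∀ la : BoundedCores s (n * t),
      -- the size of the orbit
      (coreStabilizer s t hst ⟨la.1, la.2.1⟩).Finite ∧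
      ((boundedOrbit s t (n * t) hst la).ncard : ℚ) =
        (n : ℚ) ^ (s - 1) * s ! / (coreStabilizer s t hst ⟨la.1, la.2.1⟩).ncard ∧
      -- the unique `(s, t)`-core in the orbit is the `t`-core of each member
      ∃ mu ∈ boundedOrbit s t (n * t) hst la,
        IsCore t mu.1 ∧
        (∀ nu ∈ boundedOrbit s t (n * t) hst la, IsCore t nu.1 → nu = mu) ∧
        ∀ ka ∈ boundedOrbit s t (n * t) hst la, ∀ nu : YoungDiagram,
          IsCoreOf t nu ka.1 ↔ nu = mu.1 := by
  have hs0 : 0 < s := by omega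
  have ht : 0 < t := pos_of_coprime hs hst
  refine ⟨isActionGraph_actsOnCores hs0 ht hst,
    isActionGraph_actsOnBoundedCores hs0 ht hst (Nat.mul_pos hn ht),
    finite_boundedCores hs0 ht hst (Nat.mul_pos hn ht),
    exists_boundedCore_of_isCore hs0 ht hst (Nat.le_mul_of_pos_left t hn), fun la => ?_⟩
  have hcard := ncard_boundedOrbit_mul_ncard_coreStabilizer hs0 ht hst hn la
  have hne : (coreStabilizer s t hst ⟨la.1, la.2.1⟩).ncard ≠ 0 :=
    right_ne_zero_of_mul (hcard.trans_ne (by positivity))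
  obtain ⟨mu, hmu, hcore⟩ := exists_isCore_mem_boundedOrbit hs hst hn la
  have hcoreOf (ka) (hka : ka ∈ boundedOrbit s t (n * t) hst la) (nu : YoungDiagram) :
      IsCoreOf t nu ka.1 ↔ nu = mu.1 :=
    isCoreOf_iff_of_mem_boundedOrbit hs0 ht hst hn hmu hcore hka nu
  exact ⟨Set.finite_of_ncard_ne_zero hne,
    eq_div_of_mul_eq (by exact_mod_cast hne) (by exact_mod_cast hcard), mu, hmu, hcore,
    fun nu hnu hnu' => Subtype.ext ((hcoreOf nu hnu nu.1).1 ⟨hnu', .refl⟩), hcoreOf⟩
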